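/- **Setting.** Let $I=(0,1]$ and $n\ge 0$. For $d,m,k\in\mathbb N_0$ let $\widetilde{\mathcal E}_\tau(\mathbb R^d\times\mathbb R^m)$ be the space of nets $(u_\varepsilon)_{\varepsilon\in I}$ of smooth functions of $(t,x)\in\mathbb R^d\times\mathbb R^m$, all of whose derivatives grow at most polynomially in $x$, uniformly for $t$ in compact sets (for each $\varepsilon$), such that for every compact $K\subset\mathbb R^d$ and every multi-index $\alpha$ there is $r\in\mathbb N$ with $$\sup_{t\in K,\,x\in\mathbb R^m}(1+|x|)^{-r}|\partial^\alpha u_\varepsilon(t,x)|=O(\varepsilon^{-r})\quad(\varepsilon\to0).$$ Let $\widetilde{\mathcal N}_\tau(\mathbb R^d\times\mathbb R^m)$ be the subspace of those nets for which, for every $K$ and $\alpha$, there is $r$ such that for all $s\in\mathbb N$ this supremum is $O(\varepsilon^{s})$, and put $\widetilde{\mathcal G}_\tau=\widetilde{\mathcal E}_\tau/\widetilde{\mathcal N}_\tau$. For $d=0$ this is the algebra $\mathcal G_\tau(\mathbb R^m)$ of tempered generalized functions. Composition and restriction are defined by inserting representatives. A *generalized group action* on $\mathbb R^m$ is an element $\Phi\in(\widetilde{\mathcal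 G}_\tau(\mathbb R\times\mathbb R^m))^m$ such that $\Phi(0,\cdot)=\mathrm{id}$ in $(\mathcal G_\tau(\mathbb R^m))^m$ and $\Phi(\eta_1+\eta_2,\cdot)=\Phi(\eta_1,\Phi(\eta_2,\cdot))$ in $(\widetilde{\mathcal G}_\tau(\mathbb R^2\times\mathbb R^m))^m$. A generalized group action $\Phi$ on $\mathbb R^p\times\mathbb R^q$ is *projectable* if $\Phi(\eta,(x,u))=(\Xi_\eta(x),\Psi_\eta(x,u))$ with $\Xi\in(\widetilde{\mathcal G}_\tau(\mathbb R\times\mathbb R^p))^p$ and $\Psi\in(\widetilde{\mathcal G}_\tau(\mathbb R\times\mathbb R^{p+q}))^q$. Let $(\mathbb R^p\times\mathbb R^q)^{(n)}$ be the $n$-jet space, with points $z=(x,(z_\alpha)_{|\alpha|\le n})$, $x\in\mathbb R^p$, $z_\alpha\in\mathbb R^q$, $\alpha\in\mathbb N_0^p$; let $\mathrm{pr}^{(n)}f(y)=(\partial^\alpha f(y))_{|\alpha|\le n}$ for smooth $f:\mathbb R^p\to\mathbb R^q$; and let $h_z(y)=\sum_{|\alpha|\le n}\frac{(y-x)^\alpha}{\alpha!}z_\alpha$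 be the Taylor polynomial with $(x,\mathrm{pr}^{(n)}h_z(x))=z$. For a projectable $\Phi=(\Xi,\Psi)$ and representatives $(\xi_\varepsilon)$ of $\Xi$ and $(\psi_\varepsilon)$ of $\Psi$, the $n$-th prolongation $\mathrm{pr}^{(n)}\Phi$ is the class of the net $$(\eta,z)\mapsto\Bigl(\xi_\varepsilon(\eta,x),\ \mathrm{pr}^{(n)}\bigl[\,y\mapsto\psi_\varepsilon\bigl(\eta,\,(\xi_\varepsilon(-\eta,y),\,h_z(\xi_\varepsilon(-\eta,y)))\bigr)\bigr](\xi_\varepsilon(\eta,x))\Bigr).$$ **Proposition 4.13.** Let $\Phi$ be a projectable generalized group action on $\mathbb R^p\times\mathbb R^q$. Then for every $n\ge0$ the $n$-th prolongation $\mathrm{pr}^{(n)}\Phi$ is a well-defined element of $\widetilde{\mathcal G}_\tau\bigl(\mathbb R\times(\mathbb R^p\times\mathbb R^q)^{(n)}\bigr)^N$, $N=\dim(\mathbb R^p\times\mathbb R^q)^{(n)}$ (the net above is in $\widetilde{\mathcal E}_\tau$, and its class does not depend on the representatives), and it is a generalized group action on $(\mathbb R^p\times\mathbb R^q)^{(n)}$.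 -/

import Mathlib

open scoped ContDiff

noncomputable section

namespace Colombeau

/-- The index set `I = (0, 1]` of the regularization parameter `ε`. -/
abbrev Idx : Type := Set.Ioc (0 : ℝ) 1

section Algebras

variable (T E F : Type*)
  [NormedAddCommGroup T] [NormedSpace ℝ T]
  [NormedAddCommGroup E] [NormedSpace ℝ E]
  [NormedAddCommGroup F] [NormedSpace ℝ F]

/-- Nets `(u_ε)` of functions of `(t, x) ∈ T × E` with values in `F`. With `F = ℝ^m` such a net is
an `m`-tuple of nets of scalar functions, and all bounds below hold for it if and only if they hold
for each component. Norms on the finite-dimensional spaces `T`, `E`, `F` only matter up to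
equivalence, and bounding `‖iteratedFDeriv ℝ k f‖` amounts to bounding all `∂^α f` with
`|α| = k`. -/
abbrev Net : Type _ := Idx → T × E → F

variable {T E F}

/-- Smooth functions on `T × E` all of whose derivatives grow at most polynomially in `x ∈ E`,
uniformly for `t` in compact subsets of `T`. -/
def SlowlyIncreasing (f : T × E → F) : Prop :=
  ContDiff ℝ ∞ f ∧ ∀ K : Set T, IsCompact K → ∀ k : ℕ, ∃ (p : ℕ) (C : ℝ), ∀ t ∈ K, ∀ x : E,
    ‖iteratedFDeriv ℝ k f (t, x)‖ ≤ C * (1 + ‖x‖) ^ p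

/-- The moderate nets: `𝒢`-bounds in `t` (locally uniform), `𝒢_τ`-bounds in `x` (global, with
polynomial weights). -/
def IsModerate (u : Net T E F) : Prop :=
  (∀ ε, SlowlyIncreasing (u ε)) ∧
  ∀ K : Set T, IsCompact K → ∀ k : ℕ, ∃ (p : ℕ) (C ε₀ : ℝ), 0 < ε₀ ∧
    ∀ ε : Idx, (ε : ℝ) < ε₀ → ∀ t ∈ K, ∀ x : E,
      ‖iteratedFDeriv ℝ k (u ε) (t, x)‖ ≤ C * (ε : ℝ)⁻¹ ^ p * (1 + ‖x‖) ^ p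

/-- The negligible nets. -/
def IsNegligible (u : Net T E F) : Prop :=
  (∀ ε, SlowlyIncreasing (u ε)) ∧
  ∀ K : Set T, IsCompact K → ∀ k : ℕ, ∃ p : ℕ, ∀ q : ℕ, ∃ C ε₀ : ℝ, 0 < ε₀ ∧
    ∀ ε : Idx, (ε : ℝ) < ε₀ → ∀ t ∈ K, ∀ x : E,
      ‖iteratedFDeriv ℝ k (u ε) (t, x)‖ ≤ C * (ε : ℝ) ^ q * (1 + ‖x‖) ^ p

/-- The ideal `𝒩_τ` of negligible nets of slowly increasing functions on `E` (without
parameter `t`), where `Function.HasTemperateGrowth` is membership in `𝒪_M`. -/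
def IsNegligibleTau (u : Idx → E → F) : Prop :=
  (∀ ε, (u ε).HasTemperateGrowth) ∧
  ∀ k : ℕ, ∃ p : ℕ, ∀ q : ℕ, ∃ C ε₀ : ℝ, 0 < ε₀ ∧
    ∀ ε : Idx, (ε : ℝ) < ε₀ → ∀ x : E,
      ‖iteratedFDeriv ℝ k (u ε) x‖ ≤ C * (ε : ℝ) ^ q * (1 + ‖x‖) ^ p

theorem SlowlyIncreasing.zero : SlowlyIncreasing (0 : T × E → F) :=
  ⟨contDiff_const, fun _ _ k => ⟨0, 0, fun t _ x => by simp⟩⟩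

theorem norm_iteratedFDeriv_add_le {f g : T × E → F} (hf : ContDiff ℝ ∞ f)
    (hg : ContDiff ℝ ∞ g) (k : ℕ) (s : T × E) :
    ‖iteratedFDeriv ℝ k (f + g) s‖ ≤ ‖iteratedFDeriv ℝ k f s‖ + ‖iteratedFDeriv ℝ k g s‖ := by
  have hk : ((k : ℕ∞) : WithTop ℕ∞) ≤ ∞ := by exact_mod_cast le_top
  rw [iteratedFDeriv_add_apply (hf.of_le hk).contDiffAt (hg.of_le hk).contDiffAt]
  exact norm_add_le _ _

theorem norm_iteratedFDeriv_smul_eq {f : T × E → F} (hf : ContDiff ℝ ∞ f) (c : ℝ) (k : ℕ)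
    (s : T × E) : ‖iteratedFDeriv ℝ k (c • f) s‖ = |c| * ‖iteratedFDeriv ℝ k f s‖ := by
  have hk : ((k : ℕ∞) : WithTop ℕ∞) ≤ ∞ := by exact_mod_cast le_top
  rw [iteratedFDeriv_const_smul_apply (hf.of_le hk).contDiffAt, norm_smul, Real.norm_eq_abs]

theorem bound_mono {C A a b : ℝ} {p r : ℕ} (hC : C ≤ A) (hA : 0 ≤ A) (ha : 1 ≤ a) (hab : a ≤ b)
    (hpr : p ≤ r) : C * a ^ p ≤ A * b ^ r := by
  have h1 : a ^ p ≤ b ^ r :=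
    (pow_le_pow_right₀ ha hpr).trans (pow_le_pow_left₀ (zero_le_one.trans ha) hab r)
  exact (mul_le_mul_of_nonneg_right hC (by positivity)).trans (mul_le_mul_of_nonneg_left h1 hA)

theorem SlowlyIncreasing.add {f g : T × E → F} (hf : SlowlyIncreasing f)
    (hg : SlowlyIncreasing g) : SlowlyIncreasing (f + g) := by
  refine ⟨hf.1.add hg.1, fun K hK k => ?_⟩
  obtain ⟨p, C, h⟩ := hf.2 K hK k
  obtain ⟨p', C', h'⟩ := hg.2 K hK k
  refine ⟨max p p', |C| + |C'|, fun t ht x => ?_⟩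
  have hx : (1 : ℝ) ≤ 1 + ‖x‖ := by linarith [norm_nonneg x]
  have h1 := bound_mono (le_abs_self C) (abs_nonneg C) hx le_rfl (le_max_left p p')
  have h2 := bound_mono (le_abs_self C') (abs_nonneg C') hx le_rfl (le_max_right p p')
  linarith [norm_iteratedFDeriv_add_le hf.1 hg.1 k (t, x), h t ht x, h' t ht x]

theorem SlowlyIncreasing.smul {f : T × E → F} (c : ℝ) (hf : SlowlyIncreasing f) :
    SlowlyIncreasing (c • f) := by
  refine ⟨contDiff_const.smul hf.1, fun K hK k => ?_⟩
  obtain ⟨p, C, h⟩ := hf.2 K hK k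
  refine ⟨p, |c| * C, fun t ht x => ?_⟩
  rw [norm_iteratedFDeriv_smul_eq hf.1, mul_assoc]
  exact mul_le_mul_of_nonneg_left (h t ht x) (abs_nonneg c)

variable (T E F)

/-- The space `ℰ̃_τ(T × E)` of moderate nets. -/
def moderate : Submodule ℝ (Net T E F) where
  carrier := {u | IsModerate u}
  zero_mem' := ⟨fun _ => SlowlyIncreasing.zero, fun K _ k =>
    ⟨0, 0, 1, one_pos, fun ε _ t _ x => by simp⟩⟩
  add_mem' := by
    rintro u v ⟨hu, hu'⟩ ⟨hv, hv'⟩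
    refine ⟨fun ε => (hu ε).add (hv ε), fun K hK k => ?_⟩
    obtain ⟨p, C, e, he, h⟩ := hu' K hK k
    obtain ⟨p', C', e', he', h'⟩ := hv' K hK k
    refine ⟨max p p', |C| + |C'|, min e e', lt_min he he', fun ε hε t ht x => ?_⟩
    have hx : (1 : ℝ) ≤ 1 + ‖x‖ := by linarith [norm_nonneg x]
    have hi : 1 ≤ (ε : ℝ)⁻¹ := (one_le_inv₀ ε.2.1).2 ε.2.2
    have hm : 1 ≤ (ε : ℝ)⁻¹ * (1 + ‖x‖) := one_le_mul_of_one_le_of_one_le hi hx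
    have h1 := bound_mono (le_abs_self C) (abs_nonneg C) hm le_rfl (le_max_left p p')
    have h2 := bound_mono (le_abs_self C') (abs_nonneg C') hm le_rfl (le_max_right p p')
    have h3 := h ε (hε.trans_le (min_le_left _ _)) t ht x
    have h4 := h' ε (hε.trans_le (min_le_right _ _)) t ht x
    rw [mul_assoc, ← mul_pow] at h3 h4 ⊢
    have h5 := norm_iteratedFDeriv_add_le (hu ε).1 (hv ε).1 k (t, x)
    rw [Pi.add_apply]
    linarith
  smul_mem' := by
    rintro c u ⟨hu, hu'⟩
    refine ⟨fun ε => (hu ε).smul c, fun K hK k => ?_⟩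
    obtain ⟨p, C, e, he, h⟩ := hu' K hK k
    refine ⟨p, |c| * C, e, he, fun ε hε t ht x => ?_⟩
    rw [Pi.smul_apply, norm_iteratedFDeriv_smul_eq (hu ε).1, mul_assoc, mul_assoc, ← mul_assoc C]
    exact mul_le_mul_of_nonneg_left (h ε hε t ht x) (abs_nonneg c)

/-- The space `𝒩̃_τ(T × E)` of negligible nets. -/
def negligible : Submodule ℝ (Net T E F) where
  carrier := {u | IsNegligible u}
  zero_mem' := ⟨fun _ => SlowlyIncreasing.zero, fun K _ k =>
    ⟨0, fun q => ⟨0, 1, one_pos, fun ε _ t _ x => by simp⟩⟩⟩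
  add_mem' := by
    rintro u v ⟨hu, hu'⟩ ⟨hv, hv'⟩
    refine ⟨fun ε => (hu ε).add (hv ε), fun K hK k => ?_⟩
    obtain ⟨p, H⟩ := hu' K hK k
    obtain ⟨p', H'⟩ := hv' K hK k
    refine ⟨max p p', fun q => ?_⟩
    obtain ⟨C, e, he, h⟩ := H q
    obtain ⟨C', e', he', h'⟩ := H' q
    refine ⟨|C| + |C'|, min e e', lt_min he he', fun ε hε t ht x => ?_⟩
    have hx : (1 : ℝ) ≤ 1 + ‖x‖ := by linarith [norm_nonneg x]
    have hq : 0 ≤ (ε : ℝ) ^ q := pow_nonneg ε.2.1.le q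
    have h1 := bound_mono (mul_le_mul_of_nonneg_right (le_abs_self C) hq)
      (mul_nonneg (abs_nonneg C) hq) hx le_rfl (le_max_left p p')
    have h2 := bound_mono (mul_le_mul_of_nonneg_right (le_abs_self C') hq)
      (mul_nonneg (abs_nonneg C') hq) hx le_rfl (le_max_right p p')
    have h3 := h ε (hε.trans_le (min_le_left _ _)) t ht x
    have h4 := h' ε (hε.trans_le (min_le_right _ _)) t ht x
    have h5 := norm_iteratedFDeriv_add_le (hu ε).1 (hv ε).1 k (t, x)
    rw [Pi.add_apply]
    linarith
  smul_mem' := by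
    rintro c u ⟨hu, hu'⟩
    refine ⟨fun ε => (hu ε).smul c, fun K hK k => ?_⟩
    obtain ⟨p, H⟩ := hu' K hK k
    refine ⟨p, fun q => ?_⟩
    obtain ⟨C, e, he, h⟩ := H q
    refine ⟨|c| * C, e, he, fun ε hε t ht x => ?_⟩
    rw [Pi.smul_apply, norm_iteratedFDeriv_smul_eq (hu ε).1, mul_assoc, mul_assoc, ← mul_assoc C]
    exact mul_le_mul_of_nonneg_left (h ε hε t ht x) (abs_nonneg c)

/-- The space `𝒢̃_τ(T × E)` of `F`-valued generalized functions: moderate nets modulo negligible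
nets. For `F = ℝ^m` this is `(𝒢̃_τ(T × E))^m`. -/
abbrev GTilde : Type _ := moderate T E F ⧸ (negligible T E F).submoduleOf (moderate T E F)

variable {T E F}

/-- `u` is a representative of `U`, that is, `u` is moderate and `U = cl[u]`. -/
def Represents (u : Net T E F) (U : GTilde T E F) : Prop :=
  ∃ hu : u ∈ moderate T E F, Submodule.Quotient.mk ⟨u, hu⟩ = U

end Algebras

section GroupActions

variable {E : Type*} [NormedAddCommGroup E] [NormedSpace ℝ E]

/-- A generalized group action on `E = ℝ^n`: an element `Φ` of `(𝒢̃_τ(ℝ × E))^n` with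
`Φ(0, ·) = id` in `(𝒢_τ(E))^n` and `Φ(η₁ + η₂, ·) = Φ(η₁, Φ(η₂, ·))` in `(𝒢̃_τ(ℝ² × E))^n`.
Restriction and composition of generalized functions are insertion into representatives, and
equality of classes says that the difference of representatives is negligible. -/
def IsGeneralizedGroupAction (Φ : GTilde ℝ E E) : Prop :=
  ∀ φ : Net ℝ E E, Represents φ Φ →
    IsNegligibleTau (fun ε (x : E) => φ ε (0, x) - x) ∧
    IsNegligible (fun ε (s : (ℝ × ℝ) × E) =>
      φ ε (s.1.1 + s.1.2, s.2) - φ ε (s.1.1, φ ε (s.1.2, s.2)))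

end GroupActions

section Projectable

variable {X U : Type*}
  [NormedAddCommGroup X] [NormedSpace ℝ X] [NormedAddCommGroup U] [NormedSpace ℝ U]

/-- The net `(η, (x, u)) ↦ (ξ_ε(η, x), ψ_ε(η, (x, u)))`. -/
def pairNet (ξ : Net ℝ X X) (ψ : Net ℝ (X × U) U) : Net ℝ (X × U) (X × U) :=
  fun ε s => (ξ ε (s.1, s.2.1), ψ ε s)

/-- `Φ(η, (x, u)) = (Ξ_η(x), Ψ_η(x, u))`, where `Ξ` and `Ψ` are the classes of the moderate nets
`ξ` and `ψ`. -/
def IsSplitting (Φ : GTilde ℝ (X × U) (X × U)) (ξ : Net ℝ X X) (ψ : Net ℝ (X × U) U) : Prop :=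
  ξ ∈ moderate ℝ X X ∧ ψ ∈ moderate ℝ (X × U) U ∧ Represents (pairNet ξ ψ) Φ

/-- `Φ` is of the form `Φ(η, (x, u)) = (Ξ_η(x), Ψ_η(x, u))`. -/
def IsProjectable (Φ : GTilde ℝ (X × U) (X × U)) : Prop :=
  ∃ (ξ : Net ℝ X X) (ψ : Net ℝ (X × U) U), IsSplitting Φ ξ ψ

end Projectable

section Jets

/-- `ℝ^m` (with the maximum norm, which is equivalent to the Euclidean one). -/
abbrev RSpace (m : ℕ) : Type := Fin m → ℝ

/-- Multi-indices `α ∈ ℕ^p` with `|α| ≤ n` (all entries are then at most `n`). -/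
abbrev MultiIndex (p n : ℕ) : Type := {α : Fin p → Fin (n + 1) // ∑ i, (α i : ℕ) ≤ n}

/-- The jet space `(ℝ^p × ℝ^q)^{(n)}`: points `x ∈ ℝ^p` together with a value in `ℝ^q` for each
derivative `∂^α`, `|α| ≤ n`. -/
abbrev JetSpace (p q n : ℕ) : Type := RSpace p × (MultiIndex p n → RSpace q)

variable {p q : ℕ}

/-- The partial derivative `∂_i f`. -/
def partialDeriv (i : Fin p) (f : RSpace p → RSpace q) : RSpace p → RSpace q :=
  fun y => fderiv ℝ f y (Pi.single i 1)

/-- `∂^α f = ∂_1^{α_1} ⋯ ∂_p^{α_p} f`. -/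
def multiDeriv (α : Fin p → ℕ) (f : RSpace p → RSpace q) : RSpace p → RSpace q :=
  (List.finRange p).foldr (fun i g => (partialDeriv i)^[α i] g) f

/-- The `n`-th prolongation `pr^{(n)} f (y) = (∂^α f (y))_{|α| ≤ n}` of a function. -/
def prFun (n : ℕ) (f : RSpace p → RSpace q) (y : RSpace p) : MultiIndex p n → RSpace q :=
  fun α => multiDeriv (fun i => (α.1 i : ℕ)) f y

/-- The Taylor polynomial `h` with `(x, pr^{(n)} h (x)) = z`, where `z = (x, (z_α)_α)`:
`h(y) = ∑_{|α| ≤ n} (y - x)^α / α! · z_α`. -/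
def taylorPoly {n : ℕ} (z : JetSpace p q n) (y : RSpace p) : RSpace q :=
  ∑ α : MultiIndex p n,
    (∏ i, (y i - z.1 i) ^ (α.1 i : ℕ) / (Nat.factorial (α.1 i : ℕ) : ℝ)) • z.2 α

/-- The net of functions `y ↦ ψ_ε(η, (ξ_ε(-η, y), h(ξ_ε(-η, y))))`, that is, `Φ_η(h)`, the
transform of the function `h` under `Φ_η = (Ξ_η, Ψ_η)`. -/
def actOnFun (ξ : Net ℝ (RSpace p) (RSpace p)) (ψ : Net ℝ (RSpace p × RSpace q) (RSpace q))
    (ε : Idx) (η : ℝ) (h : RSpace p → RSpace q) : RSpace p → RSpace q :=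
  fun y => ψ ε (η, (ξ ε (-η, y), h (ξ ε (-η, y))))

/-- The net `(η, z) ↦ (Ξ_η(x), pr^{(n)}(Φ_η(h_z))(Ξ_η(x)))`, where `x` is the base point of `z` and
`h_z` is the Taylor polynomial of `z`. -/
def prNet (n : ℕ) (ξ : Net ℝ (RSpace p) (RSpace p))
    (ψ : Net ℝ (RSpace p × RSpace q) (RSpace q)) : Net ℝ (JetSpace p q n) (JetSpace p q n) :=
  fun ε s => (ξ ε (s.1, s.2.1),
    prFun n (actOnFun ξ ψ ε s.1 (taylorPoly s.2)) (ξ ε (s.1, s.2.1)))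

/-- `P = pr^{(n)} Φ` for a projectable `Φ`: every representative of `Φ` of the form `(ξ, ψ)` gives a
representative `prNet n ξ ψ` of `P`. -/
def IsProlongation (n : ℕ)
    (Φ : GTilde ℝ (RSpace p × RSpace q) (RSpace p × RSpace q))
    (P : GTilde ℝ (JetSpace p q n) (JetSpace p q n)) : Prop :=
  ∀ (ξ : Net ℝ (RSpace p) (RSpace p)) (ψ : Net ℝ (RSpace p × RSpace q) (RSpace q)),
    IsSplitting Φ ξ ψ → Represents (prNet n ξ ψ) P

end Jets

end Colombeau

end

/-! The proof rests on two facts: for moderate nets, equality of classes can be tested without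
derivatives, and the `n`-jet of a transformed function depends only on the `n`-jet of the original
function.

Analysis. By the Landau inequality, a first derivative is controlled by the function and its second
derivative. If a moderate net is negligible at order zero, each further derivative is therefore
negligible too (`IsModerate.isNegligible`). Hence equality of classes is the relation `Near`.
Nearness survives insertion of moderate nets, where the mean value inequality handles the inner
argument (`Near.insert`), and differentiation (`Near.fderiv_apply`). Independence of representatives
and all "up to negligible" computations reduce to these rules.

Geometry. By the chain rule, the `n`-jet at `y` of the transform of `h` under `Φ_η` depends only on
the `n`-jet of `h` at `ξ_ε(-η, y)`, so `h` may be replaced by its Taylor polynomial there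
(`prFun_transform_congr`, `jetNet_transNet`). This identity is exact for each `ε`.

Group law. Transforms of functions satisfy `Φ_{η₁+η₂} h ≈ Φ_{η₁}(Φ_{η₂} h)` (`transNet_add_near`).
Take `h = h_z` as a moderate family in `z`, form jets, and evaluate at `ξ_ε(η₁+η₂, x) ≈ ξ_ε(η₁,
ξ_ε(η₂, x))`. The exact jet identity turns the right side into a prolongation applied to a jet based
at `ξ_ε(-η₁, ξ_ε(η₁, ξ_ε(η₂, x)))`. This base point is only near `ξ_ε(η₂, x)`, and insertion absorbs
the error. -/

noncomputable section

namespace Colombeau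

open Filter Topology

set_option linter.unusedSectionVars false

/-! ### Moderate nets and their stability under composition and differentiation. -/

section Growth

variable {T T' E E' F F' : Type*}
  [NormedAddCommGroup T] [NormedSpace ℝ T] [NormedAddCommGroup T'] [NormedSpace ℝ T']
  [NormedAddCommGroup E] [NormedSpace ℝ E] [NormedAddCommGroup E'] [NormedSpace ℝ E']
  [NormedAddCommGroup F] [NormedSpace ℝ F] [NormedAddCommGroup F'] [NormedSpace ℝ F']

/-- The filter `ε → 0` on the index set. -/
def atZero : Filter Idx := comap Subtype.val (𝓝[>] (0 : ℝ))

theorem eventually_atZero {P : Idx → Prop} :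
    (∀ᶠ ε in atZero, P ε) ↔ ∃ ε₀ : ℝ, 0 < ε₀ ∧ ∀ ε : Idx, (ε : ℝ) < ε₀ → P ε := by
  rw [atZero, ((nhdsGT_basis (0 : ℝ)).comap Subtype.val).eventually_iff]
  refine exists_congr fun e => and_congr_right fun _ => ?_
  exact ⟨fun h ε hε => h ⟨ε.2.1, hε⟩, fun h ε hε => h ε hε.2⟩

/-- The filters along which a moderate net has to satisfy polynomial bounds: the filter `ε → 0`
for moderateness proper, and the principal filters at single indices for slow increase. -/
def IsTestFilter (l : Filter Idx) : Prop := l = atZero ∨ ∃ ε, l = pure ε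

/-- The weight `ε⁻¹ (1 + ‖x‖)`. -/
def weight (ε : Idx) (x : E) : ℝ := (ε : ℝ)⁻¹ * (1 + ‖x‖)

theorem one_le_inv_idx (ε : Idx) : 1 ≤ (ε : ℝ)⁻¹ := (one_le_inv₀ ε.2.1).2 ε.2.2

theorem one_add_norm_le_weight (ε : Idx) (x : E) : 1 + ‖x‖ ≤ weight ε x :=
  le_mul_of_one_le_left (by positivity) (one_le_inv_idx ε)

theorem one_le_weight (ε : Idx) (x : E) : 1 ≤ weight ε x :=
  le_trans (by linarith [norm_nonneg x]) (one_add_norm_le_weight ε x)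

/-- Polynomial bounds of order zero along the filter `l`. -/
def PolyBounded (l : Filter Idx) (f : Idx → T × E → F) : Prop :=
  ∀ K : Set T, IsCompact K → ∃ (p : ℕ) (C : ℝ), 1 ≤ C ∧
    ∀ᶠ ε in l, ∀ t ∈ K, ∀ x : E, ‖f ε (t, x)‖ ≤ C * weight ε x ^ p

theorem PolyBounded.mono {l : Filter Idx} {f : Idx → T × E → F} {g : Idx → T × E → F'} {c : ℝ}
    (hf : PolyBounded l f) (h : ∀ ε s, ‖g ε s‖ ≤ c * ‖f ε s‖) : PolyBounded l g := by
  intro K hK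
  obtain ⟨p, C, hC, H⟩ := hf K hK
  refine ⟨p, (1 + |c|) * C, by nlinarith [abs_nonneg c], ?_⟩
  filter_upwards [H] with ε H t ht x
  have h1 := H t ht x
  calc ‖g ε (t, x)‖ ≤ c * ‖f ε (t, x)‖ := h ε _
    _ ≤ (1 + |c|) * ‖f ε (t, x)‖ := by
        gcongr; linarith [le_abs_self c]
    _ ≤ (1 + |c|) * (C * weight ε x ^ p) := by gcongr
    _ = _ := by ring

/-- Finitely many polynomial bounds hold simultaneously. -/
theorem PolyBounded.uniform {F : ℕ → Type*} [∀ k, NormedAddCommGroup (F k)] {l : Filter Idx}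
    {f : ∀ k, Idx → T × E → F k} (hf : ∀ k, PolyBounded l (f k)) {K : Set T} (hK : IsCompact K)
    (N : ℕ) : ∃ (p : ℕ) (C : ℝ), 1 ≤ C ∧
      ∀ᶠ ε in l, ∀ k ≤ N, ∀ t ∈ K, ∀ x : E, ‖f k ε (t, x)‖ ≤ C * weight ε x ^ p := by
  have mono : ∀ {C D w : ℝ} {p q : ℕ}, 1 ≤ C → C ≤ D → 1 ≤ w → p ≤ q → C * w ^ p ≤ D * w ^ q :=
    fun h1 h2 h3 h4 => bound_mono h2 (by linarith) h3 le_rfl h4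
  induction N with
  | zero =>
    obtain ⟨p, C, hC, H⟩ := hf 0 K hK
    refine ⟨p, C, hC, ?_⟩
    filter_upwards [H] with ε H k hk
    obtain rfl : k = 0 := by omega
    exact H
  | succ N ih =>
    obtain ⟨p, C, hC, H⟩ := ih
    obtain ⟨p', C', hC', H'⟩ := hf (N + 1) K hK
    refine ⟨max p p', max C C', hC.trans (le_max_left _ _), ?_⟩
    filter_upwards [H, H'] with ε H H' k hk t ht x
    rcases hk.lt_or_eq with hk | rfl
    · exact (H k (by omega) t ht x).trans
        (mono hC (le_max_left _ _) (one_le_weight ε x) (le_max_left _ _))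
    · exact (H' t ht x).trans
        (mono hC' (le_max_right _ _) (one_le_weight ε x) (le_max_right _ _))

theorem PolyBounded.prodMk {l : Filter Idx} {f : Idx → T × E → F} {g : Idx → T × E → F'}
    (hf : PolyBounded l f) (hg : PolyBounded l g) :
    PolyBounded l (fun ε s => (f ε s, g ε s)) := by
  intro K hK
  obtain ⟨p, C, hC, H⟩ := hf K hK
  obtain ⟨p', C', hC', H'⟩ := hg K hK
  refine ⟨max p p', max C C', hC.trans (le_max_left _ _), ?_⟩
  filter_upwards [H, H'] with ε H H' t ht x
  have h0 : 0 ≤ max C C' := by linarith [le_max_left C C']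
  refine max_le ?_ ?_
  · exact (H t ht x).trans
      (bound_mono (le_max_left _ _) h0 (one_le_weight ε x) le_rfl (le_max_left _ _))
  · exact (H' t ht x).trans
      (bound_mono (le_max_right _ _) h0 (one_le_weight ε x) le_rfl (le_max_right _ _))

/-- Along the principal filter at one index the factor `ε⁻¹ ^ p` is a constant, so slow increase of
a single member is the same kind of bound as moderateness. Each stability proof can then be given
once, for all test filters. -/
theorem isModerate_iff {u : Net T E F} :
    IsModerate u ↔ (∀ ε, ContDiff ℝ ∞ (u ε)) ∧
      ∀ l, IsTestFilter l → ∀ k : ℕ, PolyBounded l (fun ε => iteratedFDeriv ℝ k (u ε)) := by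
  constructor
  · rintro ⟨h1, h2⟩
    refine ⟨fun ε => (h1 ε).1, ?_⟩
    rintro l (rfl | ⟨ε, rfl⟩) k K hK
    · obtain ⟨p, C, e, he, H⟩ := h2 K hK k
      refine ⟨p, max C 1, le_max_right _ _, eventually_atZero.2 ⟨e, he, fun ε hε t ht x => ?_⟩⟩
      refine (H ε hε t ht x).trans ?_
      have : 0 ≤ (ε : ℝ)⁻¹ := by linarith [one_le_inv_idx ε]
      rw [weight, mul_pow, ← mul_assoc]
      gcongr
      exact le_max_left _ _
    · obtain ⟨p, C, H⟩ := (h1 ε).2 K hK k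
      refine ⟨p, max C 1, le_max_right _ _, ?_⟩
      simp only [eventually_pure]
      intro t ht x
      refine (H t ht x).trans ?_
      have := one_add_norm_le_weight ε x
      gcongr
      exact le_max_left _ _
  · rintro ⟨h1, h2⟩
    refine ⟨fun ε => ⟨h1 ε, fun K hK k => ?_⟩, fun K hK k => ?_⟩
    · obtain ⟨p, C, -, H⟩ := h2 _ (Or.inr ⟨ε, rfl⟩) k K hK
      refine ⟨p, C * (ε : ℝ)⁻¹ ^ p, fun t ht x => ?_⟩
      rw [mul_assoc, ← mul_pow]
      exact eventually_pure.1 H t ht x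
    · obtain ⟨p, C, -, H⟩ := h2 _ (Or.inl rfl) k K hK
      obtain ⟨e, he, H⟩ := eventually_atZero.1 H
      refine ⟨p, C, e, he, fun ε hε t ht x => ?_⟩
      rw [mul_assoc, ← mul_pow]
      exact H ε hε t ht x

theorem IsModerate.contDiff {u : Net T E F} (hu : IsModerate u) (ε : Idx) :
    ContDiff ℝ ∞ (u ε) := (hu.1 ε).1

theorem IsModerate.polyBounded {u : Net T E F} (hu : IsModerate u) {l : Filter Idx}
    (hl : IsTestFilter l) (k : ℕ) : PolyBounded l (fun ε => iteratedFDeriv ℝ k (u ε)) :=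
  (isModerate_iff.1 hu).2 l hl k

theorem IsModerate.polyBounded_zero {u : Net T E F} (hu : IsModerate u) {l : Filter Idx}
    (hl : IsTestFilter l) : PolyBounded l u :=
  (hu.polyBounded hl 0).mono (c := 1) fun ε s => by simp

theorem natCast_le_infty (k : ℕ) : ((k : ℕ∞) : WithTop ℕ∞) ≤ ∞ := by exact_mod_cast le_top

theorem IsModerate.prodMk {u : Net T E F} {v : Net T E F'} (hu : IsModerate u)
    (hv : IsModerate v) : IsModerate (fun ε s => (u ε s, v ε s)) := by
  refine isModerate_iff.2 ⟨fun ε => (hu.contDiff ε).prodMk (hv.contDiff ε), fun l hl k => ?_⟩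
  refine ((hu.polyBounded hl k).prodMk (hv.polyBounded hl k)).mono (c := 1) fun ε s => ?_
  rw [iteratedFDeriv_prodMk (hu.contDiff ε).contDiffAt (hv.contDiff ε).contDiffAt
    (natCast_le_infty k), ContinuousMultilinearMap.opNorm_prod, one_mul, Prod.norm_def]

theorem IsModerate.pi {ι : Type*} [Fintype ι] {u : ι → Net T E F} (hu : ∀ i, IsModerate (u i)) :
    IsModerate (fun ε s i => u i ε s) := by
  refine isModerate_iff.2 ⟨fun ε => contDiff_pi.2 fun i => (hu i).contDiff ε, fun l hl k => ?_⟩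
  have key : PolyBounded l
      (fun ε s => fun i : ι => iteratedFDeriv ℝ k (u i ε) s) := by
    intro K hK
    choose p C hC H using fun i => (hu i).polyBounded hl k K hK
    refine ⟨Finset.univ.sup p, 1 + ∑ i, C i, ?_, ?_⟩
    · linarith [Finset.sum_nonneg fun i (_ : i ∈ Finset.univ) => zero_le_one.trans (hC i)]
    · filter_upwards [eventually_all.2 H] with ε H t ht x
      have h0 : 0 ≤ ∑ i, C i := Finset.sum_nonneg fun i _ => zero_le_one.trans (hC i)
      have hw := one_le_weight ε x
      refine (pi_norm_le_iff_of_nonneg (by positivity)).2 fun i => (H i t ht x).trans ?_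
      refine bound_mono ?_ (by linarith) hw le_rfl (Finset.le_sup (Finset.mem_univ i))
      linarith [Finset.single_le_sum (fun j _ => zero_le_one.trans (hC j)) (Finset.mem_univ i)]
  refine key.mono (c := 1) fun ε s => ?_
  have h1 : iteratedFDeriv ℝ k (fun s i => u i ε s) s =
      ContinuousMultilinearMap.pi fun i => iteratedFDeriv ℝ k (u i ε) s := by
    ext m i
    have h := ContinuousLinearMap.iteratedFDeriv_comp_left
      (ContinuousLinearMap.proj (R := ℝ) (φ := fun _ : ι => F) i)
      ((contDiff_pi.2 fun i => (hu i).contDiff ε).contDiffAt (x := s)) (natCast_le_infty k)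
    have h' := congrArg (fun M => M m) h
    exact h'.symm
  rw [h1, ContinuousMultilinearMap.opNorm_pi, one_mul]

/-- The Faà di Bruno estimate asks for bounds `D ^ i` on the derivatives of order `i ≥ 1`; since `D
≥ 1`, a uniform bound `D` suffices. -/
theorem norm_iteratedFDeriv_comp_le_of_one_le {g : F → F'} {f : E → F} (hg : ContDiff ℝ ∞ g)
    (hf : ContDiff ℝ ∞ f) {n : ℕ} {x : E} {C D : ℝ}
    (hC : ∀ i ≤ n, ‖iteratedFDeriv ℝ i g (f x)‖ ≤ C)
    (hD : ∀ i ≤ n, ‖iteratedFDeriv ℝ i f x‖ ≤ D) (h1 : 1 ≤ D) :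
    ‖iteratedFDeriv ℝ n (fun y => g (f y)) x‖ ≤ n.factorial * C * D ^ n :=
  norm_iteratedFDeriv_comp_le hg hf (natCast_le_infty n) x hC fun i hi hin =>
    (hD i hin).trans (le_self_pow₀ h1 (by omega))

/-- Moderate nets are stable under composition, if the inner net maps compact sets of
parameters into compact sets. -/
theorem IsModerate.comp {u : Net T' E' F} {g : Net T E (T' × E')} (hu : IsModerate u)
    (hg : IsModerate g)
    (hK : ∀ K : Set T, IsCompact K → ∃ K' : Set T', IsCompact K' ∧
      ∀ ε, ∀ t ∈ K, ∀ x, (g ε (t, x)).1 ∈ K') :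
    IsModerate (fun ε s => u ε (g ε s)) := by
  refine isModerate_iff.2 ⟨fun ε => (hu.contDiff ε).comp (hg.contDiff ε), fun l hl k K hKc => ?_⟩
  obtain ⟨K', hK'c, hK'⟩ := hK K hKc
  obtain ⟨p, C, hC, H⟩ := PolyBounded.uniform (fun k => hu.polyBounded hl k) hK'c k
  obtain ⟨p', D, hD, H'⟩ := PolyBounded.uniform (fun k => hg.polyBounded hl k) hKc k
  -- The weight at the inner value is at most `2 * D * W ^ (p' + 1)`, the extra factor `W` absorbing
  -- `ε⁻¹`. It enters to the power `p`, and the inner derivatives contribute `(D * W ^ p') ^ k`.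
  refine ⟨(p' + 1) * p + p' * k, k.factorial * (C * (2 * D) ^ p) * D ^ k, ?_, ?_⟩
  · have h1 : (1 : ℝ) ≤ k.factorial := by exact_mod_cast k.factorial_pos
    have h2 : (1 : ℝ) ≤ (2 * D) ^ p := one_le_pow₀ (by linarith)
    exact one_le_mul_of_one_le_of_one_le (one_le_mul_of_one_le_of_one_le h1
      (one_le_mul_of_one_le_of_one_le hC h2)) (one_le_pow₀ hD)
  · filter_upwards [H, H'] with ε H H' t ht x
    have hw := one_le_weight ε x
    have hwp : 1 ≤ weight ε x ^ p' := one_le_pow₀ hw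
    set W := weight ε x
    have hgn : ‖(g ε (t, x)).2‖ ≤ D * W ^ p' :=
      (norm_snd_le _).trans (by simpa using H' 0 (Nat.zero_le _) t ht x)
    have hε := one_le_inv_idx ε
    have hWε : (ε : ℝ)⁻¹ ≤ W := le_mul_of_one_le_right (by linarith) (by linarith [norm_nonneg x])
    have hDW : 1 ≤ D * W ^ p' := one_le_mul_of_one_le_of_one_le hD hwp
    have hwt : weight ε (g ε (t, x)).2 ≤ 2 * D * W ^ (p' + 1) := by
      calc weight ε (g ε (t, x)).2 = (ε : ℝ)⁻¹ * (1 + ‖(g ε (t, x)).2‖) := rfl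
        _ ≤ W * (1 + D * W ^ p') := by gcongr
        _ ≤ W * (2 * (D * W ^ p')) := by gcongr; linarith
        _ = _ := by ring
    have hcomp := norm_iteratedFDeriv_comp_le_of_one_le (hu.contDiff ε) (hg.contDiff ε) (n := k)
      (x := (t, x)) (C := C * (2 * D * W ^ (p' + 1)) ^ p) (D := D * W ^ p') ?_
      (fun i hi => H' i hi t ht x) hDW
    · refine hcomp.trans (le_of_eq ?_)
      rw [mul_pow, mul_pow D, ← pow_mul, ← pow_mul, pow_add]
      ring
    · intro i hi
      have := H i hi _ (hK' ε t ht x) (g ε (t, x)).2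
      refine this.trans ?_
      have := one_le_weight ε (g ε (t, x)).2
      gcongr

/-- Functions of temperate growth define constant moderate nets. -/
theorem IsModerate.of_hasTemperateGrowth {f : T × E → F} (hf : f.HasTemperateGrowth) :
    IsModerate (fun _ : Idx => f) := by
  refine isModerate_iff.2 ⟨fun _ => hf.1, fun l hl k K hK => ?_⟩
  obtain ⟨p, C, H⟩ := hf.2 k
  obtain ⟨R, hR⟩ := hK.isBounded.exists_norm_le
  refine ⟨p, max 1 C * (1 + |R|) ^ p, ?_, Eventually.of_forall fun ε t ht x => ?_⟩
  · exact one_le_mul_of_one_le_of_one_le (le_max_left _ _)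
      (one_le_pow₀ (by linarith [abs_nonneg R]))
  · have h1 : ‖(t, x)‖ ≤ |R| + ‖x‖ :=
      max_le (by linarith [hR t ht, le_abs_self R, norm_nonneg x])
        (by linarith [abs_nonneg R])
    have hR0 := abs_nonneg R
    have hx := norm_nonneg x
    calc _ ≤ C * (1 + ‖(t, x)‖) ^ p := H _
      _ ≤ max 1 C * ((1 + |R|) * weight ε x) ^ p := by
        gcongr
        · exact le_max_right _ _
        · have := one_add_norm_le_weight ε x
          calc 1 + ‖(t, x)‖ ≤ (1 + |R|) * (1 + ‖x‖) := by nlinarith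
            _ ≤ _ := by gcongr
      _ = _ := by rw [mul_pow, mul_assoc]

theorem IsModerate.of_clm (A : T × E →L[ℝ] F) : IsModerate (fun (_ : Idx) s => A s) :=
  IsModerate.of_hasTemperateGrowth A.hasTemperateGrowth

theorem IsModerate.snd : IsModerate (fun (_ : Idx) (s : T × E) => s.2) :=
  IsModerate.of_clm (ContinuousLinearMap.snd ℝ T E)

/-- Insertion of a moderate net, and of a linear change of parameters, into a moderate net. -/
theorem IsModerate.insert {u : Net T' E' F} {v : Net T E E'} (hu : IsModerate u)
    (L : T →L[ℝ] T') (hv : IsModerate v) : IsModerate (fun ε s => u ε (L s.1, v ε s)) := by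
  refine hu.comp (g := fun ε s => (L s.1, v ε s))
    ((IsModerate.of_clm (L.comp (ContinuousLinearMap.fst ℝ T E))).prodMk hv) fun K hK => ?_
  exact ⟨L '' K, hK.image L.continuous, fun ε t ht x => ⟨t, ht, rfl⟩⟩

/-- Derivatives of moderate nets in a fixed direction are moderate. -/
theorem IsModerate.fderiv_apply {u : Net T E F} (hu : IsModerate u) (v : T × E) :
    IsModerate (fun ε s => fderiv ℝ (u ε) s v) := by
  have hc : ∀ ε, ContDiff ℝ ∞ (fderiv ℝ (u ε)) := fun ε =>
    (hu.contDiff ε).fderiv_right (by simp)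
  refine isModerate_iff.2 ⟨fun ε => (hc ε).clm_apply contDiff_const, fun l hl k => ?_⟩
  refine (hu.polyBounded hl (k + 1)).mono (c := ‖ContinuousLinearMap.apply ℝ F v‖) fun ε s => ?_
  have := ContinuousLinearMap.norm_iteratedFDeriv_comp_left (ContinuousLinearMap.apply ℝ F v)
    ((hc ε).contDiffAt (x := s)) (natCast_le_infty k)
  rw [norm_iteratedFDeriv_fderiv] at this
  exact this

end Growth

/-! ### Negligibility at order zero, nearness, and the Landau inequality. -/

section Near

variable {T T' E E' F F' : Type*}
  [NormedAddCommGroup T] [NormedSpace ℝ T] [NormedAddCommGroup T'] [NormedSpace ℝ T']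
  [NormedAddCommGroup E] [NormedSpace ℝ E] [NormedAddCommGroup E'] [NormedSpace ℝ E']
  [NormedAddCommGroup F] [NormedSpace ℝ F] [NormedAddCommGroup F'] [NormedSpace ℝ F']

/-- Negligibility bounds of order zero. -/
def NegBounded (f : Idx → T × E → F) : Prop :=
  ∀ K : Set T, IsCompact K → ∃ p : ℕ, ∀ q : ℕ, ∃ C : ℝ, 0 ≤ C ∧
    ∀ᶠ ε in atZero, ∀ t ∈ K, ∀ x : E, ‖f ε (t, x)‖ ≤ C * (ε : ℝ) ^ q * (1 + ‖x‖) ^ p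

theorem isNegligible_iff {u : Net T E F} :
    IsNegligible u ↔ (∀ ε, SlowlyIncreasing (u ε)) ∧
      ∀ k : ℕ, NegBounded (fun ε => iteratedFDeriv ℝ k (u ε)) := by
  refine and_congr_right fun _ => ⟨fun h k K hK => ?_, fun h K hK k => ?_⟩
  · obtain ⟨p, H⟩ := h K hK k
    refine ⟨p, fun q => ?_⟩
    obtain ⟨C, e, he, H⟩ := H q
    refine ⟨max C 0, le_max_right _ _, eventually_atZero.2 ⟨e, he, fun ε hε t ht x => ?_⟩⟩
    refine (H ε hε t ht x).trans ?_
    have := ε.2.1.le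
    gcongr
    exact le_max_left _ _
  · obtain ⟨p, H⟩ := h k K hK
    refine ⟨p, fun q => ?_⟩
    obtain ⟨C, -, H⟩ := H q
    obtain ⟨e, he, H⟩ := eventually_atZero.1 H
    exact ⟨C, e, he, H⟩

theorem NegBounded.mono {f : Idx → T × E → F} {g : Idx → T × E → F'} {c : ℝ}
    (hf : NegBounded f) (h : ∀ ε s, ‖g ε s‖ ≤ c * ‖f ε s‖) : NegBounded g := by
  intro K hK
  obtain ⟨p, H⟩ := hf K hK
  refine ⟨p, fun q => ?_⟩
  obtain ⟨C, hC, H⟩ := H q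
  refine ⟨|c| * C, by positivity, ?_⟩
  filter_upwards [H] with ε H t ht x
  calc ‖g ε (t, x)‖ ≤ c * ‖f ε (t, x)‖ := h ε _
    _ ≤ |c| * (C * (ε : ℝ) ^ q * (1 + ‖x‖) ^ p) :=
        mul_le_mul (le_abs_self c) (H t ht x) (norm_nonneg _) (abs_nonneg c)
    _ = _ := by ring

theorem NegBounded.of_add {f : Idx → T × E → F} {g : Idx → T × E → F'} {h : Idx → T × E → E'}
    (hf : NegBounded f) (hg : NegBounded g) (H : ∀ ε s, ‖h ε s‖ ≤ ‖f ε s‖ + ‖g ε s‖) :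
    NegBounded h := by
  intro K hK
  obtain ⟨p, Hf⟩ := hf K hK
  obtain ⟨p', Hg⟩ := hg K hK
  refine ⟨max p p', fun q => ?_⟩
  obtain ⟨C, hC, Hf⟩ := Hf q
  obtain ⟨C', hC', Hg⟩ := Hg q
  refine ⟨C + C', by positivity, ?_⟩
  filter_upwards [Hf, Hg] with ε Hf Hg t ht x
  have hx : (1 : ℝ) ≤ 1 + ‖x‖ := by linarith [norm_nonneg x]
  have hq : 0 ≤ (ε : ℝ) ^ q := pow_nonneg ε.2.1.le q
  have h1 := bound_mono (le_refl (C * (ε : ℝ) ^ q)) (by positivity) hx le_rfl (le_max_left p p')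
  have h2 := bound_mono (le_refl (C' * (ε : ℝ) ^ q)) (by positivity) hx le_rfl (le_max_right p p')
  linarith [H ε (t, x), Hf t ht x, Hg t ht x]

/-- Two nets are near each other if their difference satisfies the negligibility bounds of order
zero. For moderate nets this is equality of classes. -/
def Near (u v : Net T E F) : Prop := NegBounded (fun ε s => u ε s - v ε s)

theorem Near.of_eq {u v : Net T E F} (h : ∀ ε s, u ε s = v ε s) : Near u v := fun _ _ =>
  ⟨0, fun _ => ⟨0, le_rfl, Eventually.of_forall fun _ _ _ _ => by simp [h]⟩⟩

theorem Near.refl (u : Net T E F) : Near u u := Near.of_eq fun _ _ => rfl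

theorem Near.symm {u v : Net T E F} (h : Near u v) : Near v u :=
  NegBounded.mono h (c := 1) fun ε s => by rw [one_mul, norm_sub_rev]

theorem Near.trans {u v w : Net T E F} (h : Near u v) (h' : Near v w) : Near u w :=
  NegBounded.of_add h h' fun _ _ => norm_sub_le_norm_sub_add_norm_sub _ _ _

theorem Near.prodMk {u u' : Net T E F} {v v' : Net T E F'} (h : Near u u') (h' : Near v v') :
    Near (fun ε s => (u ε s, v ε s)) (fun ε s => (u' ε s, v' ε s)) :=
  NegBounded.of_add h h' fun ε s => by
    simp [Prod.norm_def]

theorem Near.pi {ι : Type*} [Fintype ι] {u v : ι → Net T E F} (h : ∀ i, Near (u i) (v i)) :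
    Near (fun ε s i => u i ε s) (fun ε s i => v i ε s) := by
  intro K hK
  choose p H using fun i => h i K hK
  refine ⟨Finset.univ.sup p, fun q => ?_⟩
  choose C hC H using fun i => H i q
  have hS : 0 ≤ ∑ i, C i := Finset.sum_nonneg fun i _ => hC i
  refine ⟨∑ i, C i, hS, ?_⟩
  filter_upwards [eventually_all.2 H] with ε H t ht x
  have hε := ε.2.1.le
  refine (pi_norm_le_iff_of_nonneg (by positivity)).2 fun i => (H i t ht x).trans ?_
  have hx : (1 : ℝ) ≤ 1 + ‖x‖ := by linarith [norm_nonneg x]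
  refine bound_mono ?_ (by positivity) hx le_rfl (Finset.le_sup (Finset.mem_univ i))
  gcongr
  exact Finset.single_le_sum (fun j _ => hC j) (Finset.mem_univ i)

theorem Near.clm_comp {u v : Net T E F} (h : Near u v) (A : F →L[ℝ] F') :
    Near (fun ε s => A (u ε s)) (fun ε s => A (v ε s)) :=
  NegBounded.mono h (c := ‖A‖) fun ε s => by rw [← map_sub]; exact A.le_opNorm _

theorem eps_pow_mul_inv_pow (ε : Idx) (q p : ℕ) :
    (ε : ℝ) ^ (q + p) * (ε : ℝ)⁻¹ ^ p = (ε : ℝ) ^ q := by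
  have : (ε : ℝ) ≠ 0 := ε.2.1.ne'
  rw [pow_add, mul_assoc, ← mul_pow, mul_inv_cancel₀ this, one_pow, mul_one]

theorem one_add_norm_le_of_polyBounded {ε : Idx} {x : E} {y : E'} {D : ℝ} {p : ℕ} (hD : 1 ≤ D)
    (hy : ‖y‖ ≤ D * weight ε x ^ p) : 1 + ‖y‖ ≤ 2 * D * weight ε x ^ p := by
  have := one_le_mul_of_one_le_of_one_le hD (one_le_pow₀ (n := p) (one_le_weight ε x))
  linarith

/-- Nets that are near each other stay near each other after insertion of a moderate net. -/
theorem Near.insert_left {u u' : Net T' E' F} {v : Net T E E'} (h : Near u u') (L : T →L[ℝ] T')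
    (hv : IsModerate v) :
    Near (fun ε s => u ε (L s.1, v ε s)) (fun ε s => u' ε (L s.1, v ε s)) := by
  intro K hK
  obtain ⟨p, H⟩ := h (L '' K) (hK.image L.continuous)
  obtain ⟨r, D, hD, Hv⟩ := hv.polyBounded_zero (Or.inl rfl) K hK
  refine ⟨r * p, fun q => ?_⟩
  -- The inserted net costs up to `ε⁻¹ ^ (r * p)`, so that many extra powers of `ε` are requested.
  -- The growth exponent `r * p` stays independent of `q`.
  obtain ⟨C, hC, H⟩ := H (q + r * p)
  refine ⟨C * (2 * D) ^ p, by positivity, ?_⟩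
  filter_upwards [H, Hv] with ε H Hv t ht x
  have h1 := one_add_norm_le_of_polyBounded hD (Hv t ht x)
  have hε := ε.2.1.le
  calc _ ≤ C * (ε : ℝ) ^ (q + r * p) * (1 + ‖v ε (t, x)‖) ^ p := H _ ⟨t, ht, rfl⟩ _
    _ ≤ C * (ε : ℝ) ^ (q + r * p) * (2 * D * weight ε x ^ r) ^ p := by gcongr
    _ = C * (2 * D) ^ p * ((ε : ℝ) ^ (q + r * p) * (ε : ℝ)⁻¹ ^ (r * p)) *
        (1 + ‖x‖) ^ (r * p) := by
      rw [weight, mul_pow (2 * D), ← pow_mul, mul_pow _ _ (r * p)]; ring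
    _ = _ := by rw [eps_pow_mul_inv_pow]

/-- Inserting nets that are near each other into a moderate net gives nets near each other. -/
theorem Near.insert_right {u : Net T' E' F} {v v' : Net T E E'} (hu : IsModerate u)
    (L : T →L[ℝ] T') (hv : IsModerate v) (hv' : IsModerate v') (h : Near v v') :
    Near (fun ε s => u ε (L s.1, v ε s)) (fun ε s => u ε (L s.1, v' ε s)) := by
  intro K hK
  obtain ⟨m, M, hM, Hu⟩ := hu.polyBounded (Or.inl rfl) 1 (L '' K) (hK.image L.continuous)
  obtain ⟨r, D, hD, Hv⟩ := (hv.prodMk hv').polyBounded_zero (Or.inl rfl) K hK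
  obtain ⟨p, H⟩ := h K hK
  refine ⟨r * m + p, fun q => ?_⟩
  -- The derivative of `u` on the ball of radius `R = D * weight ^ r` costs `ε⁻¹ ^ m` directly and
  -- `ε⁻¹ ^ (r * m)` through `R`.
  obtain ⟨C, hC, H⟩ := H (q + (m + r * m))
  refine ⟨M * (2 * D) ^ m * C, by positivity, ?_⟩
  filter_upwards [Hu, H, Hv] with ε Hu H Hv t ht x
  have hε := ε.2.1.le
  set R := D * weight ε x ^ r with hR
  have hb : ∀ y ∈ Metric.closedBall (0 : E') R,
      ‖fderiv ℝ (fun y => u ε (L t, y)) y‖ ≤ M * ((ε : ℝ)⁻¹ * (2 * R)) ^ m := by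
    intro y hy
    have hy : ‖y‖ ≤ R := by simpa using hy
    have h1 := one_add_norm_le_of_polyBounded hD hy
    have h2 : fderiv ℝ (fun y => u ε (L t, y)) y =
        (fderiv ℝ (u ε) (L t, y)).comp (ContinuousLinearMap.inr ℝ T' E') :=
      (((hu.contDiff ε).differentiable (by simp) _).hasFDerivAt.comp y
        (hasFDerivAt_prodMk_right (L t) y)).fderiv
    have h3 := Hu (L t) ⟨t, ht, rfl⟩ y
    rw [← norm_iteratedFDeriv_fderiv, norm_iteratedFDeriv_zero] at h3
    calc _ ≤ ‖fderiv ℝ (u ε) (L t, y)‖ * ‖ContinuousLinearMap.inr ℝ T' E'‖ := by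
            rw [h2]; exact ContinuousLinearMap.opNorm_comp_le _ _
      _ ≤ ‖fderiv ℝ (u ε) (L t, y)‖ * 1 := by
            gcongr; exact ContinuousLinearMap.norm_inr_le_one ℝ T' E'
      _ ≤ M * weight ε y ^ m := by rw [mul_one]; exact h3
      _ ≤ _ := by
        have : weight ε y ≤ (ε : ℝ)⁻¹ * (2 * R) := by
          unfold weight
          have := one_le_inv_idx ε
          gcongr
          linarith
        have h0 := one_le_weight ε y
        gcongr
  have hd : ∀ y ∈ Metric.closedBall (0 : E') R,
      DifferentiableAt ℝ (fun y => u ε (L t, y)) y := fun y _ =>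
    (((hu.contDiff ε).comp (contDiff_const.prodMk contDiff_id)).differentiable (by simp)) y
  have hv1 : v ε (t, x) ∈ Metric.closedBall (0 : E') R := by
    simpa using (norm_fst_le _).trans (Hv t ht x)
  have hv2 : v' ε (t, x) ∈ Metric.closedBall (0 : E') R := by
    simpa using (norm_snd_le _).trans (Hv t ht x)
  -- Both inserted values lie in a common convex ball on which the derivative is moderately bounded,
  -- so the mean value inequality applies.
  have hmv := (convex_closedBall (0 : E') R).norm_image_sub_le_of_norm_fderiv_le hd hb hv2 hv1
  have hw := one_le_weight ε x
  have hR0 : 0 ≤ R := by positivity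
  have hi := one_le_inv_idx ε
  calc _ ≤ M * ((ε : ℝ)⁻¹ * (2 * R)) ^ m * ‖v ε (t, x) - v' ε (t, x)‖ := hmv
    _ ≤ M * ((ε : ℝ)⁻¹ * (2 * R)) ^ m *
        (C * (ε : ℝ) ^ (q + (m + r * m)) * (1 + ‖x‖) ^ p) := by gcongr; exact H t ht x
    _ = M * (2 * D) ^ m * C * ((ε : ℝ) ^ (q + (m + r * m)) * (ε : ℝ)⁻¹ ^ (m + r * m)) *
        (1 + ‖x‖) ^ (r * m + p) := by
      rw [hR, weight, mul_pow, mul_pow 2, mul_pow D, ← pow_mul, mul_pow _ _ (r * m), mul_pow 2 D,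
        pow_add _ m (r * m), pow_add _ (r * m) p]
      ring
    _ = _ := by rw [eps_pow_mul_inv_pow]

theorem Near.insert {u u' : Net T' E' F} {v v' : Net T E E'} (h : Near u u')
    (hu : IsModerate u) (L : T →L[ℝ] T') (hv : IsModerate v) (hv' : IsModerate v')
    (h' : Near v v') :
    Near (fun ε s => u ε (L s.1, v ε s)) (fun ε s => u' ε (L s.1, v' ε s)) :=
  (Near.insert_right hu L hv hv' h').trans (h.insert_left L hv')

/-- The Landau inequality: the derivative is controlled by the function and its second
derivative. -/
theorem norm_fderiv_le_of_bounds {G : E → F} (hG : ContDiff ℝ ∞ G) {s : E} {δ A M : ℝ}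
    (hδ : 0 < δ) (hA : ∀ y ∈ Metric.closedBall s δ, ‖G y‖ ≤ A)
    (hM : ∀ y ∈ Metric.closedBall s δ, ‖fderiv ℝ (fderiv ℝ G) y‖ ≤ M) :
    ‖fderiv ℝ G s‖ ≤ 2 * A / δ + M * δ := by
  have hs : s ∈ Metric.closedBall s δ := Metric.mem_closedBall_self hδ.le
  have hA0 : 0 ≤ A := (norm_nonneg _).trans (hA s hs)
  have hM0 : 0 ≤ M := (norm_nonneg (fderiv ℝ (fderiv ℝ G) s)).trans (hM s hs)
  have hG' : ContDiff ℝ ∞ (fderiv ℝ G) := hG.fderiv_right (by simp)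
  have h1 : ∀ y ∈ Metric.closedBall s δ, ‖fderiv ℝ G y - fderiv ℝ G s‖ ≤ M * δ := fun y hy =>
    ((convex_closedBall s δ).norm_image_sub_le_of_norm_fderiv_le
      (fun z _ => hG'.differentiable (by simp) z) hM hs hy).trans (by
        gcongr; simpa [dist_eq_norm] using hy)
  refine ContinuousLinearMap.opNorm_le_of_ball hδ (by positivity) fun v hv => ?_
  by_cases hv0 : v = 0
  · simp [hv0]
  have hvn : 0 < ‖v‖ := norm_pos_iff.2 hv0
  -- Rescaling to length `δ` uses the largest increment staying in the ball. The first-order Taylor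
  -- remainder along it is at most `M * δ * δ`.
  set w : E := (δ / ‖v‖) • v with hw
  have hwn : ‖w‖ = δ := by
    rw [hw, norm_smul, Real.norm_of_nonneg (by positivity), div_mul_cancel₀ _ hvn.ne']
  have hsw : s + w ∈ Metric.closedBall s δ := by simp [hwn]
  have h2 := (convex_closedBall s δ).norm_image_sub_le_of_norm_fderiv_le'
    (fun z _ => hG.differentiable (by simp) z) h1 hs hsw
  rw [add_sub_cancel_left, hwn] at h2
  have h3 : ‖fderiv ℝ G s w‖ ≤ A + A + M * δ * δ := by
    have h4 : fderiv ℝ G s w = G (s + w) - G s - (G (s + w) - G s - fderiv ℝ G s w) := by abel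
    rw [h4]
    refine (norm_sub_le _ _).trans (add_le_add ((norm_sub_le _ _).trans
      (add_le_add (hA _ hsw) (hA _ hs))) h2)
  rw [hw, map_smul, norm_smul, Real.norm_of_nonneg (by positivity)] at h3
  have h5 : ‖fderiv ℝ G s v‖ = ‖v‖ / δ * (δ / ‖v‖ * ‖fderiv ℝ G s v‖) := by
    field_simp
  rw [h5]
  calc _ ≤ ‖v‖ / δ * (A + A + M * δ * δ) := by gcongr
    _ = _ := by field_simp; ring

/-- Negligibility bounds pass to the next derivative, given moderate bounds on the one after. -/
theorem NegBounded.fderiv [ProperSpace T] {G : Idx → T × E → F} (hG : ∀ ε, ContDiff ℝ ∞ (G ε))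
    (h : NegBounded G)
    (h2 : PolyBounded atZero (fun ε => fderiv ℝ (fderiv ℝ (G ε)))) :
    NegBounded (fun ε => fderiv ℝ (G ε)) := by
  intro K hK
  -- The step `δ` will be at most `1`, so a unit thickening of `K` contains every parameter met. It
  -- is compact because `T` is proper.
  have hK' := hK.cthickening (r := 1)
  obtain ⟨p, H⟩ := h _ hK'
  obtain ⟨m, M, hM, H2⟩ := h2 _ hK'
  refine ⟨max p m, fun q => ?_⟩
  -- With `δ = ε ^ (q + m)`, dividing `ε ^ (q + (q + m))` by `δ` leaves `ε ^ q`, and the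
  -- second-derivative term `ε⁻¹ ^ m * δ` is also `ε ^ q`.
  obtain ⟨C, hC, H⟩ := H (q + (q + m))
  refine ⟨2 * (C * 2 ^ p) + M * 2 ^ m, by positivity, ?_⟩
  filter_upwards [H, H2] with ε H H2 t ht x
  have hε := ε.2.1
  set δ := (ε : ℝ) ^ (q + m) with hδ
  have hδ0 : 0 < δ := by positivity
  have hδ1 : δ ≤ 1 := pow_le_one₀ hε.le ε.2.2
  have hx1 : 1 ≤ 1 + ‖x‖ := by linarith [norm_nonneg x]
  have hball : ∀ y ∈ Metric.closedBall (t, x) δ,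
      y.1 ∈ Metric.cthickening 1 K ∧ 1 + ‖y.2‖ ≤ 2 * (1 + ‖x‖) := by
    rintro ⟨t', x'⟩ hy
    rw [Metric.mem_closedBall, Prod.dist_eq, max_le_iff] at hy
    refine ⟨Metric.mem_cthickening_of_dist_le _ _ _ _ ht (hy.1.trans hδ1), ?_⟩
    have h5 : ‖x' - x‖ ≤ 1 := by rw [← dist_eq_norm]; exact hy.2.trans hδ1
    have h6 := norm_le_norm_add_norm_sub x x'
    rw [norm_sub_rev] at h6
    dsimp only
    linarith
  have key := norm_fderiv_le_of_bounds (hG ε) (s := (t, x)) hδ0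
    (A := C * (ε : ℝ) ^ (q + (q + m)) * (2 * (1 + ‖x‖)) ^ p)
    (M := M * ((ε : ℝ)⁻¹ * (2 * (1 + ‖x‖))) ^ m) ?_ ?_
  · refine key.trans ?_
    have e1 : 2 * (C * (ε : ℝ) ^ (q + (q + m)) * (2 * (1 + ‖x‖)) ^ p) / δ =
        2 * (C * 2 ^ p) * (ε : ℝ) ^ q * (1 + ‖x‖) ^ p := by
      rw [pow_add _ q, ← hδ, mul_pow]; field_simp
    have e2 : M * ((ε : ℝ)⁻¹ * (2 * (1 + ‖x‖))) ^ m * δ =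
        M * 2 ^ m * (ε : ℝ) ^ q * (1 + ‖x‖) ^ m := by
      rw [← eps_pow_mul_inv_pow ε q m, ← hδ, mul_pow, mul_pow]; ring
    rw [e1, e2, add_mul, add_mul]
    gcongr
    · exact le_max_left _ _
    · exact le_max_right _ _
  · intro y hy
    obtain ⟨h3, h4⟩ := hball y hy
    refine (H y.1 h3 y.2).trans ?_
    gcongr
  · intro y hy
    obtain ⟨h3, h4⟩ := hball y hy
    refine (H2 y.1 h3 y.2).trans ?_
    have h5 := one_le_weight ε y.2
    have h6 := one_le_inv_idx ε
    gcongr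
    exact mul_le_mul_of_nonneg_left h4 (by linarith)

theorem IsModerate.sub {u v : Net T E F} (hu : IsModerate u) (hv : IsModerate v) :
    IsModerate (fun ε s => u ε s - v ε s) :=
  (moderate T E F).sub_mem hu hv

theorem norm_fderiv_linearIsometryEquiv_comp (A : F ≃ₗᵢ[ℝ] F') (f : E → F) (x : E) :
    ‖fderiv ℝ (A ∘ f) x‖ = ‖fderiv ℝ f x‖ := by
  rw [← norm_iteratedFDeriv_one, ← norm_iteratedFDeriv_one]
  exact A.norm_iteratedFDeriv_comp_left f x 1

/-- A moderate net is negligible as soon as it satisfies the negligibility bounds of order zero. -/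
theorem IsModerate.isNegligible [ProperSpace T] {u : Net T E F} (hu : IsModerate u)
    (h : NegBounded u) : IsNegligible u := by
  refine isNegligible_iff.2 ⟨hu.1, fun k => ?_⟩
  induction k with
  | zero => exact h.mono (c := 1) fun ε s => by simp
  | succ k ih =>
    have hc : ∀ ε, ContDiff ℝ ∞ (iteratedFDeriv ℝ k (u ε)) := fun ε =>
      (hu.contDiff ε).iteratedFDeriv_right (m := ∞) (by exact_mod_cast le_top)
    have := NegBounded.fderiv hc ih ?_
    · exact this.mono (c := 1) fun ε s => by rw [norm_fderiv_iteratedFDeriv, one_mul]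
    · refine (hu.polyBounded (Or.inl rfl) (k + 2)).mono (c := 1) fun ε s => ?_
      rw [one_mul]
      rw [fderiv_iteratedFDeriv, norm_fderiv_linearIsometryEquiv_comp,
        ← norm_fderiv_iteratedFDeriv (n := k + 1)]

theorem Near.isNegligible [ProperSpace T] {u v : Net T E F} (h : Near u v) (hu : IsModerate u)
    (hv : IsModerate v) : IsNegligible (fun ε s => u ε s - v ε s) :=
  (hu.sub hv).isNegligible h

theorem IsNegligible.near {u v : Net T E F} (h : IsNegligible (fun ε s => u ε s - v ε s)) :
    Near u v :=
  ((isNegligible_iff.1 h).2 0).mono (c := 1) fun ε s => by simp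

/-- Derivatives of moderate nets near each other are near each other. -/
theorem Near.fderiv_apply [ProperSpace T] {u v : Net T E F} (h : Near u v) (hu : IsModerate u)
    (hv : IsModerate v) (w : T × E) :
    Near (fun ε s => fderiv ℝ (u ε) s w) (fun ε s => fderiv ℝ (v ε) s w) := by
  refine ((isNegligible_iff.1 (h.isNegligible hu hv)).2 1).mono (c := ‖w‖) fun ε s => ?_
  rw [← norm_iteratedFDeriv_fderiv, norm_iteratedFDeriv_zero,
    fderiv_fun_sub ((hu.contDiff ε).differentiable (by simp) s)
      ((hv.contDiff ε).differentiable (by simp) s), mul_comm, ← sub_apply]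
  exact ContinuousLinearMap.le_opNorm _ _

end Near

/-! ### Multi-index derivatives, jets and the chain rule. -/

section Jets

variable {p q n : ℕ}

/-- The iterated partial derivative `∂_{i_1} ⋯ ∂_{i_k} f` along a word `i_1 ⋯ i_k`. -/
def wordDeriv (w : List (Fin p)) (f : RSpace p → RSpace q) : RSpace p → RSpace q :=
  w.foldr partialDeriv f

theorem contDiff_partialDeriv {f : RSpace p → RSpace q} (hf : ContDiff ℝ ∞ f) (i : Fin p) :
    ContDiff ℝ ∞ (partialDeriv i f) :=
  (hf.fderiv_right (m := ∞) (by simp)).clm_apply contDiff_const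

theorem contDiff_wordDeriv {f : RSpace p → RSpace q} (hf : ContDiff ℝ ∞ f) (w : List (Fin p)) :
    ContDiff ℝ ∞ (wordDeriv w f) := by
  induction w with
  | nil => exact hf
  | cons i w ih => exact contDiff_partialDeriv ih i

theorem partialDeriv_comm {f : RSpace p → RSpace q} (hf : ContDiff ℝ ∞ f) (i j : Fin p) :
    partialDeriv i (partialDeriv j f) = partialDeriv j (partialDeriv i f) := by
  have hf' : Differentiable ℝ (fderiv ℝ f) :=
    (hf.fderiv_right (m := ∞) (by simp)).differentiable (by simp)
  have key : ∀ (v w y : RSpace p), fderiv ℝ (fun z => fderiv ℝ f z v) y w =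
      fderiv ℝ (fderiv ℝ f) y w v := fun v w y => by
    rw [fderiv_clm_apply (hf' y) (differentiableAt_const v)]
    simp
  funext y
  refine (key _ _ y).trans (Eq.trans ?_ (key _ _ y).symm)
  exact (hf.contDiffAt.isSymmSndFDerivAt (by simpa using natCast_le_infty 2)) _ _

/-- Partial derivatives of a smooth function commute, so only the multiplicities of the letters
matter. This is what lets a multi-index stand for every word with its letter counts. -/
theorem wordDeriv_perm {f : RSpace p → RSpace q} (hf : ContDiff ℝ ∞ f) {w w' : List (Fin p)}
    (h : w.Perm w') : wordDeriv w f = wordDeriv w' f := by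
  induction h with
  | nil => rfl
  | cons i _ ih => exact congrArg (partialDeriv i) ih
  | swap i j w => exact partialDeriv_comm (contDiff_wordDeriv hf w) j i
  | trans _ _ ih ih' => exact ih.trans ih'

/-- The sorted word of a multi-index. -/
def indexWord (α : Fin p → ℕ) : List (Fin p) :=
  (List.finRange p).flatMap fun i => List.replicate (α i) i

theorem wordDeriv_append (w w' : List (Fin p)) (f : RSpace p → RSpace q) :
    wordDeriv (w ++ w') f = wordDeriv w (wordDeriv w' f) := List.foldr_append

theorem wordDeriv_replicate (k : ℕ) (i : Fin p) (f : RSpace p → RSpace q) :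
    wordDeriv (List.replicate k i) f = (partialDeriv i)^[k] f := by
  induction k with
  | zero => rfl
  | succ k ih => rw [Function.iterate_succ_apply', ← ih]; rfl

theorem multiDeriv_eq_wordDeriv (α : Fin p → ℕ) (f : RSpace p → RSpace q) :
    multiDeriv α f = wordDeriv (indexWord α) f := by
  unfold multiDeriv indexWord
  induction List.finRange p with
  | nil => rfl
  | cons i l ih => rw [List.foldr_cons, ih, List.flatMap_cons, wordDeriv_append,
      wordDeriv_replicate]

theorem length_indexWord (α : Fin p → ℕ) : (indexWord α).length = ∑ i, α i := by
  rw [indexWord, List.length_flatMap, Fin.sum_univ_def]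
  simp

theorem count_indexWord (α : Fin p → ℕ) (i : Fin p) : (indexWord α).count i = α i := by
  rw [indexWord, List.count_flatMap]
  have : (List.count i ∘ fun j => List.replicate (α j) j) = fun j => if j = i then α j else 0 := by
    funext j
    simp [List.count_replicate]
  rw [this, ← Fin.sum_univ_def]
  simp

theorem sum_count_eq_length (w : List (Fin p)) : ∑ i, w.count i = w.length := by
  have := Multiset.sum_count_eq_card (s := Finset.univ) (m := (w : Multiset (Fin p)))
    fun _ _ => Finset.mem_univ _
  simpa using this

/-- The multi-index counting the letters of a word. -/
def countIndex (w : List (Fin p)) (hw : w.length ≤ n) : MultiIndex p n :=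
  ⟨fun i => ⟨w.count i, Nat.lt_succ_of_le (List.count_le_length.trans hw)⟩, by
    simpa [sum_count_eq_length] using hw⟩

theorem wordDeriv_eq_prFun {f : RSpace p → RSpace q} (hf : ContDiff ℝ ∞ f) (w : List (Fin p))
    (hw : w.length ≤ n) (y : RSpace p) : wordDeriv w f y = prFun n f y (countIndex w hw) := by
  rw [prFun, multiDeriv_eq_wordDeriv]
  refine congrFun (wordDeriv_perm hf (List.perm_iff_count.2 fun i => ?_)) y
  rw [count_indexWord]
  rfl

/-- The bridge between coordinate jets and Fréchet derivatives, by induction on the order. The chain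
rule can then be used in its coordinate-free form. -/
theorem iteratedFDeriv_apply_single {f : RSpace p → RSpace q} (hf : ContDiff ℝ ∞ f) {k : ℕ}
    (w : Fin k → Fin p) (y : RSpace p) :
    iteratedFDeriv ℝ k f y (fun j => Pi.single (w j) 1) = wordDeriv (List.ofFn w) f y := by
  induction k generalizing y with
  | zero => simp [wordDeriv]
  | succ k ih =>
    rw [iteratedFDeriv_succ_apply_left, List.ofFn_succ]
    have h1 : wordDeriv (List.ofFn fun i : Fin k => w i.succ) f = fun z =>
        iteratedFDeriv ℝ k f z (fun j => Pi.single (w j.succ) 1) :=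
      funext fun z => (ih _ z).symm
    have hd : DifferentiableAt ℝ (iteratedFDeriv ℝ k f) y :=
      (hf.iteratedFDeriv_right (m := ∞) (i := k) (by exact_mod_cast le_top)).differentiable
        (by simp) y
    change _ = partialDeriv (w 0) (wordDeriv (List.ofFn fun i : Fin k => w i.succ) f) y
    rw [h1, partialDeriv]
    have h2 := ((ContinuousMultilinearMap.apply ℝ (fun _ : Fin k => RSpace p) (RSpace q)
      (fun j => Pi.single (w j.succ) 1)).hasFDerivAt.comp y hd.hasFDerivAt).fderiv
    exact (congrArg (fun A => A (Pi.single (w 0) 1)) h2).symm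

/-- The `n`-jet of a smooth function determines its derivatives up to order `n` and conversely. -/
theorem prFun_eq_iff {f g : RSpace p → RSpace q} (hf : ContDiff ℝ ∞ f) (hg : ContDiff ℝ ∞ g)
    (y : RSpace p) :
    prFun n f y = prFun n g y ↔ ∀ k ≤ n, iteratedFDeriv ℝ k f y = iteratedFDeriv ℝ k g y := by
  constructor
  · intro h k hk
    -- A multilinear map is determined by its values on basis vectors, which here are entries of the
    -- jet.
    refine ContinuousMultilinearMap.toMultilinearMap_injective
      (Module.Basis.ext_multilinear (fun _ => Pi.basisFun ℝ (Fin p)) fun w => ?_)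
    have hw : (List.ofFn w).length ≤ n := by simpa using hk
    simp only [Pi.basisFun_apply]
    change iteratedFDeriv ℝ k f y _ = iteratedFDeriv ℝ k g y _
    rw [iteratedFDeriv_apply_single hf, iteratedFDeriv_apply_single hg,
      wordDeriv_eq_prFun hf _ hw, wordDeriv_eq_prFun hg _ hw, h]
  · intro h
    funext α
    simp only [prFun]
    rw [multiDeriv_eq_wordDeriv, multiDeriv_eq_wordDeriv]
    set w := indexWord fun i => (α.1 i : ℕ)
    have hw : w.length ≤ n := (length_indexWord _).trans_le α.2
    rw [← List.ofFn_get w, ← iteratedFDeriv_apply_single hf, ← iteratedFDeriv_apply_single hg,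
      h _ hw]

/-- In the Faà di Bruno formula the derivative of order `k` involves only derivatives of order at
most `k` of the inner function at `x` and of the outer function at its image. -/
theorem iteratedFDeriv_comp_congr {E F G : Type*} [NormedAddCommGroup E] [NormedSpace ℝ E]
    [NormedAddCommGroup F] [NormedSpace ℝ F] [NormedAddCommGroup G] [NormedSpace ℝ G]
    {f f' : E → F} {g g' : F → G} (hf : ContDiff ℝ ∞ f) (hf' : ContDiff ℝ ∞ f')
    (hg : ContDiff ℝ ∞ g) (hg' : ContDiff ℝ ∞ g') {x : E} {n : ℕ} (hx : f x = f' x)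
    (h : ∀ k ≤ n, iteratedFDeriv ℝ k f x = iteratedFDeriv ℝ k f' x)
    (h' : ∀ k ≤ n, iteratedFDeriv ℝ k g (f x) = iteratedFDeriv ℝ k g' (f x)) :
    ∀ k ≤ n, iteratedFDeriv ℝ k (g ∘ f) x = iteratedFDeriv ℝ k (g' ∘ f') x := by
  intro k hk
  rw [iteratedFDeriv_comp hg.contDiffAt hf.contDiffAt (natCast_le_infty k),
    iteratedFDeriv_comp hg'.contDiffAt hf'.contDiffAt (natCast_le_infty k), ← hx]
  refine Finset.sum_congr rfl fun c _ => ?_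
  have h1 : ftaylorSeries ℝ g (f x) c.length = ftaylorSeries ℝ g' (f x) c.length :=
    h' _ (c.length_le.trans hk)
  have h2 : (fun m => ftaylorSeries ℝ f x (c.partSize m)) =
      fun m => ftaylorSeries ℝ f' x (c.partSize m) :=
    funext fun m => h _ ((c.partSize_le m).trans hk)
  unfold FormalMultilinearSeries.compAlongOrderedFinpartition
  rw [h1, h2]

/-- The `n`-jet at `y` of the transform of `h` under a group action only depends on the `n`-jet of
`h` at the preimage of `y`. -/
theorem prFun_transform_congr {X : RSpace p → RSpace p} {A : RSpace p × RSpace q → RSpace q}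
    {h h' : RSpace p → RSpace q} (hX : ContDiff ℝ ∞ X) (hA : ContDiff ℝ ∞ A)
    (hh : ContDiff ℝ ∞ h) (hh' : ContDiff ℝ ∞ h') {y : RSpace p}
    (H : prFun n h (X y) = prFun n h' (X y)) :
    prFun n (fun z => A (X z, h (X z))) y = prFun n (fun z => A (X z, h' (X z))) y := by
  -- The transform factors as `A`, after the graph map `z ↦ (z, h z)`, after `X`. Only the graph map
  -- depends on `h`.
  have hs : ∀ {h : RSpace p → RSpace q}, ContDiff ℝ ∞ h →
      ContDiff ℝ ∞ (fun z : RSpace p => (z, h z)) := fun hh => contDiff_id.prodMk hh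
  rw [prFun_eq_iff hh hh'] at H
  refine (prFun_eq_iff (hA.comp ((hs hh).comp hX)) (hA.comp ((hs hh').comp hX)) y).2 ?_
  have h0 : h (X y) = h' (X y) := by
    have := H 0 (Nat.zero_le _)
    simpa using congrArg (fun M => M 0) this
  have h1 : ∀ k ≤ n, iteratedFDeriv ℝ k (fun z : RSpace p => (z, h z)) (X y) =
      iteratedFDeriv ℝ k (fun z : RSpace p => (z, h' z)) (X y) := fun k hk => by
    rw [iteratedFDeriv_prodMk (f := fun z => z) contDiffAt_id hh.contDiffAt (natCast_le_infty k),
      iteratedFDeriv_prodMk (f := fun z => z) contDiffAt_id hh'.contDiffAt (natCast_le_infty k), H k hk]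
  have h2 := iteratedFDeriv_comp_congr (hs hh) (hs hh') hA hA (x := X y) (n := n)
    (by simp [h0]) h1 fun _ _ => rfl
  exact iteratedFDeriv_comp_congr hX hX (hA.comp (hs hh)) (hA.comp (hs hh')) rfl
    (fun _ _ => rfl) h2

/-! ### Taylor polynomials with a prescribed jet. -/

section Taylor

/-- The variables are separated, so `∂_i` touches only the factor of index `i`. Derivatives of
monomials thus reduce to one-variable computations. -/
theorem partialDeriv_prod_smul {G : Fin p → ℝ → ℝ} (hG : ∀ i, ContDiff ℝ ∞ (G i)) (c : RSpace q)
    (i : Fin p) :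
    partialDeriv i (fun y => (∏ j, G j (y j)) • c) =
      fun y => (∏ j, Function.update G i (deriv (G i)) j (y j)) • c := by
  funext y
  have h1 : ∀ j ∈ Finset.univ, HasFDerivAt (fun y : RSpace p => G j (y j))
      (deriv (G j) (y j) • ContinuousLinearMap.proj (R := ℝ) (φ := fun _ : Fin p => ℝ) j) y :=
    fun j _ => (((hG j).differentiable (by simp) (y j)).hasDerivAt).comp_hasFDerivAt y
      (ContinuousLinearMap.proj (R := ℝ) (φ := fun _ : Fin p => ℝ) j).hasFDerivAt
  rw [partialDeriv, ((HasFDerivAt.finsetProd h1).smul_const c).fderiv,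
    ContinuousLinearMap.smulRight_apply]
  congr 1
  rw [← Finset.mul_prod_erase Finset.univ _ (Finset.mem_univ i)]
  have h2 : ∀ j ∈ Finset.univ.erase i, Function.update G i (deriv (G i)) j (y j) = G j (y j) :=
    fun j hj => by rw [Function.update_of_ne (Finset.ne_of_mem_erase hj)]
  rw [Finset.prod_congr rfl h2]
  simp [Pi.single_apply, mul_comm]

theorem contDiff_iteratedDeriv {g : ℝ → ℝ} (hg : ContDiff ℝ ∞ g) (k : ℕ) :
    ContDiff ℝ ∞ (iteratedDeriv k g) := by
  rw [iteratedDeriv_eq_iterate]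
  exact hg.iterate_deriv k

theorem contDiff_update_iteratedDeriv {G : Fin p → ℝ → ℝ} (hG : ∀ i, ContDiff ℝ ∞ (G i))
    (i : Fin p) (k : ℕ) (j : Fin p) :
    ContDiff ℝ ∞ (Function.update G i (iteratedDeriv k (G i)) j) := by
  rcases eq_or_ne j i with rfl | hj
  · rw [Function.update_self]
    exact contDiff_iteratedDeriv (hG j) k
  · rw [Function.update_of_ne hj]
    exact hG j

theorem iterate_partialDeriv_prod_smul {G : Fin p → ℝ → ℝ} (hG : ∀ i, ContDiff ℝ ∞ (G i))
    (c : RSpace q) (i : Fin p) (k : ℕ) :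
    (partialDeriv i)^[k] (fun y => (∏ j, G j (y j)) • c) =
      fun y => (∏ j, Function.update G i (iteratedDeriv k (G i)) j (y j)) • c := by
  induction k with
  | zero => simp
  | succ k ih =>
    rw [Function.iterate_succ_apply', ih,
      partialDeriv_prod_smul (contDiff_update_iteratedDeriv hG i k)]
    simp [iteratedDeriv_succ]

theorem multiDeriv_prod_smul {G : Fin p → ℝ → ℝ} (hG : ∀ i, ContDiff ℝ ∞ (G i)) (c : RSpace q)
    (α : Fin p → ℕ) :
    multiDeriv α (fun y => (∏ j, G j (y j)) • c) =
      fun y => (∏ j, iteratedDeriv (α j) (G j) (y j)) • c := by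
  -- Without repetitions, each factor is still undifferentiated when its own index is processed.
  have key : ∀ l : List (Fin p), l.Nodup →
      l.foldr (fun i g => (partialDeriv i)^[α i] g) (fun y => (∏ j, G j (y j)) • c) =
        fun y => (∏ j, (if j ∈ l then iteratedDeriv (α j) (G j) else G j) (y j)) • c := by
    intro l hl
    induction l with
    | nil => simp
    | cons i l ih =>
      obtain ⟨hi, hl⟩ := List.nodup_cons.1 hl
      rw [List.foldr_cons, ih hl, iterate_partialDeriv_prod_smul]
      · funext y
        congr 2
        funext j
        rcases eq_or_ne j i with rfl | hj
        · simp [hi]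
        · simp [hj]
      · intro j
        split_ifs
        · exact contDiff_iteratedDeriv (hG j) _
        · exact hG j
  rw [multiDeriv, key _ (List.nodup_finRange p)]
  simp

/-- For `a < b` a positive power of `s - x` survives and vanishes at `x`; for `a > b` the derivative
is identically zero; for `a = b` the factorials cancel. -/
theorem iteratedDeriv_divided_pow (x : ℝ) (a b : ℕ) :
    iteratedDeriv a (fun s : ℝ => (s - x) ^ b / (b.factorial : ℝ)) x = if a = b then 1 else 0 := by
  have h0 : (b.factorial : ℝ) ≠ 0 := by exact_mod_cast b.factorial_ne_zero
  have h1 : (fun s : ℝ => (s - x) ^ b / (b.factorial : ℝ)) =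
      fun s => (fun r : ℝ => (b.factorial : ℝ)⁻¹ * r ^ b) (s - x) := by
    funext s; ring
  rw [h1, iteratedDeriv_comp_sub_const a (fun r : ℝ => (b.factorial : ℝ)⁻¹ * r ^ b) x]
  dsimp only
  rw [iteratedDeriv_const_mul_field, iteratedDeriv_pow, sub_self]
  split_ifs with h
  · subst h
    simp [Nat.descFactorial_self, h0]
  · rcases lt_or_gt_of_ne h with h | h
    · simp [zero_pow (Nat.sub_ne_zero_of_lt h)]
    · simp [Nat.descFactorial_of_lt h]

theorem multiDeriv_sum {ι : Type*} (s : Finset ι) {f : ι → RSpace p → RSpace q}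
    (hf : ∀ i, ContDiff ℝ ∞ (f i)) (α : Fin p → ℕ) (y : RSpace p) :
    multiDeriv α (fun z => ∑ i ∈ s, f i z) y = ∑ i ∈ s, multiDeriv α (f i) y := by
  simp only [multiDeriv_eq_wordDeriv]
  rw [← List.ofFn_get (indexWord α),
    ← iteratedFDeriv_apply_single (ContDiff.sum fun i _ => hf i),
    iteratedFDeriv_sum fun i _ => (hf i).of_le (natCast_le_infty _), Finset.sum_apply,
    sum_apply]
  exact Finset.sum_congr rfl fun i _ => iteratedFDeriv_apply_single (hf i) _ _

theorem contDiff_divided_pow (x : ℝ) (b : ℕ) :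
    ContDiff ℝ ∞ (fun s : ℝ => (s - x) ^ b / (b.factorial : ℝ)) :=
  ((contDiff_id.sub contDiff_const).pow b).div_const _

theorem contDiff_taylorPoly (z : JetSpace p q n) : ContDiff ℝ ∞ (taylorPoly z) :=
  ContDiff.sum fun α _ => (contDiff_prod fun i _ =>
    (contDiff_divided_pow (z.1 i) (α.1 i)).comp (contDiff_apply ℝ ℝ i)).smul contDiff_const

/-- The Taylor polynomial of `z` has the `n`-jet `z`. -/
theorem prFun_taylorPoly (z : JetSpace p q n) : prFun n (taylorPoly z) z.1 = z.2 := by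
  funext α
  have hs : ∀ β : MultiIndex p n, ContDiff ℝ ∞ (fun y : RSpace p =>
      (∏ i, (y i - z.1 i) ^ (β.1 i : ℕ) / (Nat.factorial (β.1 i : ℕ) : ℝ)) • z.2 β) :=
    fun β => (contDiff_prod fun i _ =>
      (contDiff_divided_pow (z.1 i) (β.1 i)).comp (contDiff_apply ℝ ℝ i)).smul contDiff_const
  rw [prFun]
  refine (multiDeriv_sum Finset.univ hs _ _).trans ?_
  rw [Finset.sum_eq_single α]
  · rw [multiDeriv_prod_smul fun i => contDiff_divided_pow (z.1 i) (α.1 i)]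
    simp only [iteratedDeriv_divided_pow, if_true, Finset.prod_const_one, one_smul]
  · intro β _ hβ
    rw [multiDeriv_prod_smul fun i => contDiff_divided_pow (z.1 i) (β.1 i)]
    obtain ⟨i, hi⟩ : ∃ i, α.1 i ≠ β.1 i := by
      by_contra! h
      exact hβ (Subtype.ext (funext fun i => (h i).symm))
    have : (∏ j, iteratedDeriv (α.1 j : ℕ)
        (fun s : ℝ => (s - z.1 j) ^ (β.1 j : ℕ) / ((β.1 j : ℕ).factorial : ℝ)) (z.1 j)) = 0 :=
      Finset.prod_eq_zero (Finset.mem_univ i) (by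
        rw [iteratedDeriv_divided_pow, if_neg fun h => hi (Fin.ext h)])
    simp only [this, zero_smul]
  · simp

theorem hasTemperateGrowth_prod {E ι : Type*} [NormedAddCommGroup E] [NormedSpace ℝ E]
    (s : Finset ι) {f : ι → E → ℝ} (hf : ∀ i, (f i).HasTemperateGrowth) :
    Function.HasTemperateGrowth (fun x => ∏ i ∈ s, f i x) := by
  classical
  induction s using Finset.induction_on with
  | empty => simp
  | insert i s hi ih =>
    simp only [Finset.prod_insert hi]
    exact (hf i).mul ih

/-- The expression is polynomial jointly in the jet and the evaluation point. Joint growth is what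
makes all Taylor polynomials together a moderate family, with the jet as a global variable. -/
theorem hasTemperateGrowth_taylorPoly :
    Function.HasTemperateGrowth
      (fun s : JetSpace p q n × RSpace p => taylorPoly s.1 s.2) := by
  refine Function.HasTemperateGrowth.sum fun α _ => ?_
  refine Function.HasTemperateGrowth.fun_smul (hasTemperateGrowth_prod _ fun i => ?_) ?_
  · have h1 : Function.HasTemperateGrowth
        (fun s : JetSpace p q n × RSpace p => s.2 i - s.1.1 i) :=
      (((ContinuousLinearMap.proj (R := ℝ) (φ := fun _ : Fin p => ℝ) i).comp
        (ContinuousLinearMap.snd ℝ (JetSpace p q n) (RSpace p))) -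
        ((ContinuousLinearMap.proj (R := ℝ) (φ := fun _ : Fin p => ℝ) i).comp
          ((ContinuousLinearMap.fst ℝ (RSpace p) (MultiIndex p n → RSpace q)).comp
            (ContinuousLinearMap.fst ℝ (JetSpace p q n) (RSpace p))))).hasTemperateGrowth
    simp only [div_eq_mul_inv]
    exact (h1.fun_pow _).mul (Function.HasTemperateGrowth.const _)
  · exact ((ContinuousLinearMap.proj (R := ℝ) (φ := fun _ : MultiIndex p n => RSpace q) α).comp
      ((ContinuousLinearMap.snd ℝ (RSpace p) (MultiIndex p n → RSpace q)).comp
        (ContinuousLinearMap.fst ℝ (JetSpace p q n) (RSpace p)))).hasTemperateGrowth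

end Taylor

/-! ### Jets of nets in the last variable. -/

section JetNets

variable {T Z : Type*} [NormedAddCommGroup T] [NormedSpace ℝ T]
  [NormedAddCommGroup Z] [NormedSpace ℝ Z]

/-- Partial derivatives of a net with respect to the last variable. -/
def wordNet (w : List (Fin p)) (G : Net T (Z × RSpace p) (RSpace q)) :
    Net T (Z × RSpace p) (RSpace q) :=
  fun ε s => wordDeriv w (fun y => G ε (s.1, (s.2.1, y))) s.2.2

/-- The `n`-jet of a net with respect to the last variable. -/
def jetNet (n : ℕ) (G : Net T (Z × RSpace p) (RSpace q)) :
    Net T (Z × RSpace p) (MultiIndex p n → RSpace q) :=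
  fun ε s => prFun n (fun y => G ε (s.1, (s.2.1, y))) s.2.2

theorem partialDeriv_slice {H : T × (Z × RSpace p) → RSpace q} (hH : Differentiable ℝ H)
    (i : Fin p) (s : T × (Z × RSpace p)) :
    partialDeriv i (fun y => H (s.1, (s.2.1, y))) s.2.2 =
      fderiv ℝ H s (0, (0, Pi.single i 1)) := by
  have h := (hH s).hasFDerivAt.comp s.2.2 (HasFDerivAt.comp (g := fun u => (s.1, u))
    (f := fun y => (s.2.1, y)) s.2.2 (hasFDerivAt_prodMk_right s.1 s.2)
    (hasFDerivAt_prodMk_right s.2.1 s.2.2))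
  exact congrArg (fun A => A (Pi.single i 1)) h.fderiv

/-- A partial derivative of a slice is a directional derivative of the full net, so moderateness and
nearness pass to jets through `fderiv_apply`. -/
theorem wordNet_cons {G : Net T (Z × RSpace p) (RSpace q)} {w : List (Fin p)}
    (h : ∀ ε, ContDiff ℝ ∞ (wordNet w G ε)) (i : Fin p) :
    wordNet (i :: w) G = fun ε s => fderiv ℝ (wordNet w G ε) s (0, (0, Pi.single i 1)) := by
  funext ε s
  exact partialDeriv_slice ((h ε).differentiable (by simp)) i s

theorem IsModerate.wordNet {G : Net T (Z × RSpace p) (RSpace q)} (hG : IsModerate G)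
    (w : List (Fin p)) : IsModerate (wordNet w G) := by
  induction w with
  | nil => exact hG
  | cons i w ih =>
    rw [wordNet_cons ih.contDiff]
    exact ih.fderiv_apply _

theorem jetNet_eq (n : ℕ) (G : Net T (Z × RSpace p) (RSpace q)) :
    jetNet n G = fun ε s α => wordNet (indexWord fun i => (α.1 i : ℕ)) G ε s := by
  funext ε s α
  exact congrFun (multiDeriv_eq_wordDeriv _ _) _

theorem IsModerate.jetNet {G : Net T (Z × RSpace p) (RSpace q)} (hG : IsModerate G) (n : ℕ) :
    IsModerate (jetNet n G) := by
  rw [jetNet_eq]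
  exact IsModerate.pi fun α => hG.wordNet _

theorem Near.jetNet [ProperSpace T] {G G' : Net T (Z × RSpace p) (RSpace q)} (h : Near G G')
    (hG : IsModerate G) (hG' : IsModerate G') (n : ℕ) : Near (jetNet n G) (jetNet n G') := by
  have key : ∀ w : List (Fin p), Near (Colombeau.wordNet w G) (Colombeau.wordNet w G') := by
    intro w
    induction w with
    | nil => exact h
    | cons i w ih =>
      rw [wordNet_cons (hG.wordNet w).contDiff, wordNet_cons (hG'.wordNet w).contDiff]
      exact ih.fderiv_apply (hG.wordNet w) (hG'.wordNet w) _
  rw [jetNet_eq, jetNet_eq]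
  exact Near.pi fun α => key _

end JetNets

end Jets

/-! ### Group actions on the level of representatives. -/

section NearActions

variable {T E F : Type*} [NormedAddCommGroup T] [NormedSpace ℝ T]
  [NormedAddCommGroup E] [NormedSpace ℝ E] [NormedAddCommGroup F] [NormedSpace ℝ F]

theorem Represents.isModerate {u : Net T E F} {U : GTilde T E F} (h : Represents u U) :
    IsModerate u := h.1

theorem represents_iff_of_represents [ProperSpace T] {u v : Net T E F} {U : GTilde T E F}
    (h : Represents u U) : Represents v U ↔ IsModerate v ∧ Near u v := by
  obtain ⟨hu, rfl⟩ := h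
  constructor
  · rintro ⟨hv, h⟩
    have h1 := (Submodule.Quotient.eq _).1 h.symm
    exact ⟨hv, IsNegligible.near (u := u) (v := v) h1⟩
  · rintro ⟨hv, h⟩
    exact ⟨hv, ((Submodule.Quotient.eq _).2 (h.isNegligible hu hv)).symm⟩

/-- The group action axioms on the level of representatives, with equality of classes replaced by
nearness. -/
def IsNearAction (φ : Net ℝ E E) : Prop :=
  Near (fun ε (s : ℝ × E) => φ ε (0, s.2)) (fun _ s => s.2) ∧
  Near (fun ε (s : (ℝ × ℝ) × E) => φ ε (s.1.1 + s.1.2, s.2))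
    (fun ε s => φ ε (s.1.1, φ ε (s.1.2, s.2)))

/-- Freezing `t` is composition with an affine embedding whose linear part has norm at most one, so
derivative bounds are inherited on the compact set `{t}`. -/
theorem IsNegligible.slice {u : Net T E F} (h : IsNegligible u) (t : T) :
    IsNegligibleTau (fun ε x => u ε (t, x)) := by
  have hb : ∀ ε (k : ℕ) (x : E), ‖iteratedFDeriv ℝ k (fun x => u ε (t, x)) x‖ ≤
      ‖iteratedFDeriv ℝ k (u ε) (t, x)‖ := by
    intro ε k x
    have h1 : (fun x => u ε (t, x)) =
        (fun s => u ε ((t, 0) + s)) ∘ ContinuousLinearMap.inr ℝ T E := by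
      funext y; simp
    have hc : ContDiff ℝ ∞ (fun s => u ε ((t, 0) + s)) :=
      (h.1 ε).1.comp (contDiff_const.add contDiff_id)
    rw [h1, ContinuousLinearMap.iteratedFDeriv_comp_right _ hc x (natCast_le_infty k),
      iteratedFDeriv_comp_add_left]
    refine (ContinuousMultilinearMap.norm_compContinuousLinearMap_le _ _).trans ?_
    have h2 : (t, (0 : E)) + ContinuousLinearMap.inr ℝ T E x = (t, x) := by simp
    rw [h2]
    refine mul_le_of_le_one_right (norm_nonneg _) (Finset.prod_le_one (fun _ _ => norm_nonneg _)
      fun _ _ => ContinuousLinearMap.norm_inr_le_one ℝ T E)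
  refine ⟨fun ε => ⟨(h.1 ε).1.comp (contDiff_const.prodMk contDiff_id), fun k => ?_⟩, fun k => ?_⟩
  · obtain ⟨p, C, H⟩ := (h.1 ε).2 {t} isCompact_singleton k
    exact ⟨p, C, fun x => (hb ε k x).trans (H t rfl x)⟩
  · obtain ⟨p, H⟩ := h.2 {t} isCompact_singleton k
    refine ⟨p, fun q => ?_⟩
    obtain ⟨C, e, he, H⟩ := H q
    exact ⟨C, e, he, fun ε hε x => (hb ε k x).trans (H ε hε t rfl x)⟩

theorem IsNegligibleTau.negBounded {u : Idx → E → F} (h : IsNegligibleTau u) :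
    NegBounded (fun ε (s : T × E) => u ε s.2) := by
  intro K _
  obtain ⟨p, H⟩ := h.2 0
  refine ⟨p, fun q => ?_⟩
  obtain ⟨C, e, he, H⟩ := H q
  refine ⟨|C|, abs_nonneg C, eventually_atZero.2 ⟨e, he, fun ε hε t _ x => ?_⟩⟩
  have h1 := H ε hε x
  rw [norm_iteratedFDeriv_zero] at h1
  have := ε.2.1.le
  refine h1.trans ?_
  gcongr
  exact le_abs_self C

theorem IsModerate.group_law_left {φ : Net ℝ E E} (hφ : IsModerate φ) :
    IsModerate (fun ε (s : (ℝ × ℝ) × E) => φ ε (s.1.1 + s.1.2, s.2)) :=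
  hφ.insert (ContinuousLinearMap.fst ℝ ℝ ℝ + ContinuousLinearMap.snd ℝ ℝ ℝ) IsModerate.snd

theorem IsModerate.group_law_right {φ : Net ℝ E E} (hφ : IsModerate φ) :
    IsModerate (fun ε (s : (ℝ × ℝ) × E) => φ ε (s.1.1, φ ε (s.1.2, s.2))) :=
  hφ.insert (ContinuousLinearMap.fst ℝ ℝ ℝ)
    (hφ.insert (ContinuousLinearMap.snd ℝ ℝ ℝ) IsModerate.snd)

theorem IsGeneralizedGroupAction.isNearAction {Φ : GTilde ℝ E E}
    (hΦ : IsGeneralizedGroupAction Φ) {φ : Net ℝ E E} (hφ : Represents φ Φ) : IsNearAction φ :=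
  ⟨(hΦ φ hφ).1.negBounded, (hΦ φ hφ).2.near⟩

/-- Both axioms are built by insertion, which respects nearness in the outer and the inner net
alike. -/
theorem IsNearAction.congr {φ φ' : Net ℝ E E} (h : IsNearAction φ) (hφ : IsModerate φ)
    (hφ' : IsModerate φ') (hn : Near φ φ') : IsNearAction φ' := by
  refine ⟨(hn.symm.insert_left (0 : ℝ →L[ℝ] ℝ) IsModerate.snd).trans h.1, ?_⟩
  have h1 : Near (fun ε (s : (ℝ × ℝ) × E) => φ' ε (s.1.1 + s.1.2, s.2))
      (fun ε s => φ ε (s.1.1 + s.1.2, s.2)) :=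
    hn.symm.insert_left (ContinuousLinearMap.fst ℝ ℝ ℝ + ContinuousLinearMap.snd ℝ ℝ ℝ)
      IsModerate.snd
  exact (h1.trans h.2).trans (hn.insert hφ (ContinuousLinearMap.fst ℝ ℝ ℝ)
    (hφ.insert (ContinuousLinearMap.snd ℝ ℝ ℝ) IsModerate.snd)
    (hφ'.insert (ContinuousLinearMap.snd ℝ ℝ ℝ) IsModerate.snd)
    (hn.insert_left (ContinuousLinearMap.snd ℝ ℝ ℝ) IsModerate.snd))

/-- It suffices to check the group action axioms for a single representative. -/
theorem IsNearAction.isGeneralizedGroupAction {Φ : GTilde ℝ E E} {φ : Net ℝ E E}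
    (h : IsNearAction φ) (hφ : Represents φ Φ) : IsGeneralizedGroupAction Φ := by
  intro φ' hφ'
  have hm' : IsModerate φ' := hφ'.isModerate
  obtain ⟨h0, h1⟩ :=
    h.congr hφ.isModerate hm' ((represents_iff_of_represents hφ).1 hφ').2
  refine ⟨?_, h1.isNegligible hm'.group_law_left hm'.group_law_right⟩
  -- The identity axiom was stated with a dummy parameter; any slice of it is the required tempered
  -- statement.
  exact (h0.isNegligible (hm'.insert (0 : ℝ →L[ℝ] ℝ) IsModerate.snd) IsModerate.snd).slice 0

theorem IsNearAction.zero_apply {φ : Net ℝ E E} (h : IsNearAction φ) {v : Net T F E}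
    (hv : IsModerate v) : Near (fun ε s => φ ε (0, v ε s)) v :=
  h.1.insert_left (0 : T →L[ℝ] ℝ) hv

theorem IsNearAction.add_apply {φ : Net ℝ E E} (h : IsNearAction φ) (L L' : T →L[ℝ] ℝ)
    {v : Net T F E} (hv : IsModerate v) :
    Near (fun ε s => φ ε (L s.1 + L' s.1, v ε s)) (fun ε s => φ ε (L s.1, φ ε (L' s.1, v ε s))) :=
  h.2.insert_left (L.prod L') hv

/-- Opposite parameters add to zero, so the group law and the identity axiom cancel them. On
representatives this inversion holds only up to nearness. -/
theorem IsNearAction.apply_neg_apply {φ : Net ℝ E E} (h : IsNearAction φ) (L L' : T →L[ℝ] ℝ)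
    (hL : L + L' = 0) {v : Net T F E} (hv : IsModerate v) :
    Near (fun ε s => φ ε (L s.1, φ ε (L' s.1, v ε s))) v := by
  refine (h.add_apply L L' hv).symm.trans (Near.trans (Near.of_eq fun ε s => ?_)
    (h.zero_apply hv))
  rw [← _root_.add_apply, hL]
  rfl

end NearActions

/-! ### Components of a projectable action. -/

section Pairs

variable {X U : Type*}
  [NormedAddCommGroup X] [NormedSpace ℝ X] [NormedAddCommGroup U] [NormedSpace ℝ U]

/-- The base component ignores the fibre variable, so inserting `0` there recovers statements about
`ξ` from statements about the pair. -/
theorem isModerate_base_lift : IsModerate (fun (_ : Idx) (s : ℝ × X) => (s.2, (0 : U))) :=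
  IsModerate.of_clm ((ContinuousLinearMap.inl ℝ X U).comp (ContinuousLinearMap.snd ℝ ℝ X))

theorem Near.of_pairNet {ξ ξ' : Net ℝ X X} {ψ ψ' : Net ℝ (X × U) U}
    (h : Near (pairNet ξ ψ) (pairNet ξ' ψ')) : Near ξ ξ' ∧ Near ψ ψ' :=
  ⟨(h.clm_comp (ContinuousLinearMap.fst ℝ X U)).insert_left (ContinuousLinearMap.id ℝ ℝ)
    isModerate_base_lift, h.clm_comp (ContinuousLinearMap.snd ℝ X U)⟩

theorem IsNearAction.base {ξ : Net ℝ X X} {ψ : Net ℝ (X × U) U}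
    (h : IsNearAction (pairNet ξ ψ)) : IsNearAction ξ := by
  have hl : IsModerate (fun (_ : Idx) (s : (ℝ × ℝ) × X) => (s.2, (0 : U))) :=
    IsModerate.of_clm ((ContinuousLinearMap.inl ℝ X U).comp (ContinuousLinearMap.snd ℝ (ℝ × ℝ) X))
  exact ⟨(h.1.clm_comp (ContinuousLinearMap.fst ℝ X U)).insert_left (ContinuousLinearMap.id ℝ ℝ)
    isModerate_base_lift,
    (h.2.clm_comp (ContinuousLinearMap.fst ℝ X U)).insert_left (ContinuousLinearMap.id ℝ (ℝ × ℝ))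
    hl⟩

end Pairs

/-! ### Transforms of function families and the prolonged action. -/

section Prolongation

variable {p q n : ℕ} {T Z : Type*} [NormedAddCommGroup T] [NormedSpace ℝ T]
  [NormedAddCommGroup Z] [NormedSpace ℝ Z]

/-- The transforms under `(ξ, ψ)` of a family of functions `G_ε(t, z, ·)`, the group parameter being
the linear function `L` of `t`. -/
def transNet (ξ : Net ℝ (RSpace p) (RSpace p)) (ψ : Net ℝ (RSpace p × RSpace q) (RSpace q))
    (L : T →L[ℝ] ℝ) (G : Net T (Z × RSpace p) (RSpace q)) : Net T (Z × RSpace p) (RSpace q) :=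
  fun ε s => actOnFun ξ ψ ε (L s.1) (fun y => G ε (s.1, (s.2.1, y))) s.2.2

/-- The family of all Taylor polynomials. -/
def taylorNet (p q n : ℕ) (T : Type*) : Net T (JetSpace p q n × RSpace p) (RSpace q) :=
  fun _ s => taylorPoly s.2.1 s.2.2

theorem isModerate_taylorNet : IsModerate (taylorNet p q n T) :=
  IsModerate.of_hasTemperateGrowth (hasTemperateGrowth_taylorPoly.comp
    (ContinuousLinearMap.snd ℝ T (JetSpace p q n × RSpace p)).hasTemperateGrowth)

theorem isModerate_snd_fst {E F : Type*} [NormedAddCommGroup E] [NormedSpace ℝ E]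
    [NormedAddCommGroup F] [NormedSpace ℝ F] :
    IsModerate (fun (_ : Idx) (s : T × (E × F)) => s.2.1) :=
  IsModerate.of_clm ((ContinuousLinearMap.fst ℝ E F).comp (ContinuousLinearMap.snd ℝ T (E × F)))

theorem isModerate_snd_snd {E F : Type*} [NormedAddCommGroup E] [NormedSpace ℝ E]
    [NormedAddCommGroup F] [NormedSpace ℝ F] :
    IsModerate (fun (_ : Idx) (s : T × (E × F)) => s.2.2) :=
  IsModerate.of_clm ((ContinuousLinearMap.snd ℝ E F).comp (ContinuousLinearMap.snd ℝ T (E × F)))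

variable {ξ ξ' : Net ℝ (RSpace p) (RSpace p)} {ψ ψ' : Net ℝ (RSpace p × RSpace q) (RSpace q)}

theorem IsModerate.preimage (hξ : IsModerate ξ) (L : T →L[ℝ] ℝ) :
    IsModerate (fun ε (s : T × (Z × RSpace p)) => ξ ε (-L s.1, s.2.2)) :=
  hξ.insert (-L) isModerate_snd_snd

theorem IsModerate.graph {G : Net T (Z × RSpace p) (RSpace q)} (hG : IsModerate G)
    {v : Net T (Z × RSpace p) (RSpace p)} (hv : IsModerate v) :
    IsModerate (fun ε s => (v ε s, G ε (s.1, (s.2.1, v ε s)))) :=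
  hv.prodMk (hG.insert (ContinuousLinearMap.id ℝ T) (isModerate_snd_fst.prodMk hv))

theorem Near.graph {G G' : Net T (Z × RSpace p) (RSpace q)} (h : Near G G') (hG : IsModerate G)
    {v v' : Net T (Z × RSpace p) (RSpace p)} (hv : IsModerate v) (hv' : IsModerate v')
    (hn : Near v v') :
    Near (fun ε s => (v ε s, G ε (s.1, (s.2.1, v ε s))))
      (fun ε s => (v' ε s, G' ε (s.1, (s.2.1, v' ε s)))) :=
  hn.prodMk (h.insert hG (ContinuousLinearMap.id ℝ T) (isModerate_snd_fst.prodMk hv)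
    (isModerate_snd_fst.prodMk hv') ((Near.refl _).prodMk hn))

theorem IsModerate.transNet (hξ : IsModerate ξ) (hψ : IsModerate ψ) (L : T →L[ℝ] ℝ)
    {G : Net T (Z × RSpace p) (RSpace q)} (hG : IsModerate G) : IsModerate (transNet ξ ψ L G) :=
  hψ.insert L (hG.graph (hξ.preimage L))

theorem Near.transNet (hξ : IsModerate ξ) (hψ : IsModerate ψ) (hξ' : IsModerate ξ')
    (hnξ : Near ξ ξ') (hnψ : Near ψ ψ') (L : T →L[ℝ] ℝ)
    {G : Net T (Z × RSpace p) (RSpace q)} (hG : IsModerate G) :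
    Near (transNet ξ ψ L G) (transNet ξ' ψ' L G) :=
  hnψ.insert hψ L (hG.graph (hξ.preimage L)) (hG.graph (hξ'.preimage L))
    ((Near.refl G).graph hG (hξ.preimage L) (hξ'.preimage L)
      (hnξ.insert_left (-L) isModerate_snd_snd))

/-- The jet of a transformed family is obtained by prolonging the jet of the family. -/
theorem jetNet_transNet (hξ : IsModerate ξ) (hψ : IsModerate ψ) (L : T →L[ℝ] ℝ)
    {G : Net T (Z × RSpace p) (RSpace q)} (hG : IsModerate G) (ε : Idx) (t : T) (z : Z)
    (y : RSpace p) :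
    jetNet n (transNet ξ ψ L G) ε (t, (z, y)) =
      jetNet n (transNet ξ ψ L (taylorNet p q n T)) ε
        (t, ((ξ ε (-L t, y), jetNet n G ε (t, (z, ξ ε (-L t, y)))), y)) := by
  -- The Taylor polynomial is based at the actual preimage `ξ ε (-L t, y)`, so equality holds
  -- without any inverse law for `ξ ε`.
  refine prFun_transform_congr (X := fun z => ξ ε (-L t, z)) (A := fun u => ψ ε (L t, u))
    (h := fun y => G ε (t, (z, y)))
    (h' := taylorPoly (ξ ε (-L t, y), jetNet n G ε (t, (z, ξ ε (-L t, y)))))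
    ((hξ.contDiff ε).comp (contDiff_const.prodMk contDiff_id))
    ((hψ.contDiff ε).comp (contDiff_const.prodMk contDiff_id))
    ((hG.contDiff ε).comp (contDiff_const.prodMk (contDiff_const.prodMk contDiff_id)))
    (contDiff_taylorPoly _) ?_
  exact (prFun_taylorPoly (ξ ε (-L t, y), jetNet n G ε (t, (z, ξ ε (-L t, y))))).symm

/-- Keeping the jet `z` and the evaluation point apart lets the derivatives be taken first and the
moving point `ξ_ε(η, x)` be inserted afterwards. -/
theorem prNet_eq (n : ℕ) (ξ : Net ℝ (RSpace p) (RSpace p))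
    (ψ : Net ℝ (RSpace p × RSpace q) (RSpace q)) :
    prNet n ξ ψ = fun ε s => (ξ ε (s.1, s.2.1),
      jetNet n (transNet ξ ψ (ContinuousLinearMap.id ℝ ℝ) (taylorNet p q n ℝ)) ε
        (s.1, (s.2, ξ ε (s.1, s.2.1)))) := rfl

theorem isModerate_prNet (hξ : IsModerate ξ) (hψ : IsModerate ψ) : IsModerate (prNet n ξ ψ) := by
  rw [prNet_eq]
  have hx := hξ.insert (ContinuousLinearMap.id ℝ ℝ)
    (isModerate_snd_fst (T := ℝ) (E := RSpace p) (F := MultiIndex p n → RSpace q))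
  refine hx.prodMk ?_
  exact (((hξ.transNet hψ (ContinuousLinearMap.id ℝ ℝ)
    isModerate_taylorNet).jetNet n).insert (ContinuousLinearMap.id ℝ ℝ)
      (IsModerate.snd.prodMk hx))

theorem Near.prNet (hξ : IsModerate ξ) (hψ : IsModerate ψ) (hξ' : IsModerate ξ')
    (hψ' : IsModerate ψ') (hnξ : Near ξ ξ') (hnψ : Near ψ ψ') :
    Near (prNet n ξ ψ) (prNet n ξ' ψ') := by
  rw [prNet_eq, prNet_eq]
  have hv := isModerate_snd_fst (T := ℝ) (E := RSpace p) (F := MultiIndex p n → RSpace q)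
  have hx := hξ.insert (ContinuousLinearMap.id ℝ ℝ) hv
  have hx' := hξ'.insert (ContinuousLinearMap.id ℝ ℝ) hv
  have hn := hnξ.insert_left (ContinuousLinearMap.id ℝ ℝ) hv
  have hG := hξ.transNet hψ (ContinuousLinearMap.id ℝ ℝ)
    (isModerate_taylorNet (p := p) (q := q) (n := n))
  have hG' := hξ'.transNet hψ' (ContinuousLinearMap.id ℝ ℝ)
    (isModerate_taylorNet (p := p) (q := q) (n := n))
  refine hn.prodMk ?_
  exact (((Near.transNet hξ hψ hξ' hnξ hnψ (ContinuousLinearMap.id ℝ ℝ)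
    isModerate_taylorNet).jetNet hG hG' n).insert (hG.jetNet n) (ContinuousLinearMap.id ℝ ℝ)
      (IsModerate.snd.prodMk hx) (IsModerate.snd.prodMk hx') ((Near.refl _).prodMk hn))

theorem transNet_zero_near (hξ : IsModerate ξ)
    (h : IsNearAction (pairNet ξ ψ)) {G : Net T (Z × RSpace p) (RSpace q)} (hG : IsModerate G) :
    Near (transNet ξ ψ 0 G) G := by
  have hm : IsModerate (fun ε (s : T × (Z × RSpace p)) => ξ ε (0, s.2.2)) :=
    hξ.insert 0 isModerate_snd_snd
  have hn : Near (fun ε (s : T × (Z × RSpace p)) => ξ ε (0, s.2.2)) (fun _ s => s.2.2) :=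
    h.base.zero_apply isModerate_snd_snd
  have h1 : Near (transNet ξ ψ 0 G)
      (fun ε s => ψ ε (0, (ξ ε (0, s.2.2), G ε (s.1, (s.2.1, ξ ε (0, s.2.2)))))) :=
    Near.of_eq fun ε s => by
      change ψ ε (0, (ξ ε (-0, s.2.2), G ε (s.1, (s.2.1, ξ ε (-0, s.2.2))))) = _
      rw [neg_zero]
  -- The fibre component of the identity axiom at the graph point leaves `G` at `ξ_ε(0, y)`, which
  -- is near `y`.
  refine h1.trans (((h.zero_apply (hG.graph hm)).clm_comp
    (ContinuousLinearMap.snd ℝ (RSpace p) (RSpace q))).trans ?_)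
  exact ((Near.refl G).graph hG hm isModerate_snd_snd hn).clm_comp
    (ContinuousLinearMap.snd ℝ (RSpace p) (RSpace q))

/-- The group law for transforms of functions. -/
theorem transNet_add_near (hξ : IsModerate ξ) (hψ : IsModerate ψ)
    (h : IsNearAction (pairNet ξ ψ)) {G : Net T (Z × RSpace p) (RSpace q)} (hG : IsModerate G)
    (L L' : T →L[ℝ] ℝ) :
    Near (transNet ξ ψ (L + L') G) (transNet ξ ψ L (transNet ξ ψ L' G)) := by
  have hp := hξ.preimage (Z := Z) L
  have hpp : IsModerate (fun ε (s : T × (Z × RSpace p)) => ξ ε (-L' s.1, ξ ε (-L s.1, s.2.2))) :=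
    hξ.insert (-L') hp
  have hgr := hG.graph hpp
  -- Preimages compose in reverse order, hence the splitting as `-L'` followed on the inside by
  -- `-L`.
  have e1 : Near (fun ε (s : T × (Z × RSpace p)) => ξ ε (-(L + L') s.1, s.2.2))
      (fun ε s => ξ ε (-L' s.1, ξ ε (-L s.1, s.2.2))) :=
    Near.trans (Near.of_eq fun ε s => by rw [_root_.add_apply, neg_add_rev]; rfl)
      (h.base.add_apply (-L') (-L) isModerate_snd_snd)
  have e2 : Near (transNet ξ ψ (L + L') G) (fun ε s => ψ ε ((L + L') s.1,
      (ξ ε (-L' s.1, ξ ε (-L s.1, s.2.2)),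
        G ε (s.1, (s.2.1, ξ ε (-L' s.1, ξ ε (-L s.1, s.2.2))))))) :=
    Near.insert_right hψ (L + L') (hG.graph (hξ.preimage (L + L'))) hgr
      ((Near.refl G).graph hG (hξ.preimage (L + L')) hpp e1)
  have e3 := (h.add_apply L L' hgr).clm_comp (ContinuousLinearMap.snd ℝ (RSpace p) (RSpace q))
  -- The group law at the graph point moves the base by `L'` as well; cancelling against `-L'`
  -- leaves the base point of the iterated transform.
  have e4 : Near (fun ε (s : T × (Z × RSpace p)) =>
      ξ ε (L' s.1, ξ ε (-L' s.1, ξ ε (-L s.1, s.2.2)))) (fun ε s => ξ ε (-L s.1, s.2.2)) :=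
    h.base.apply_neg_apply L' (-L') (add_neg_cancel _) hp
  have hψm := hψ.insert L' hgr
  exact (e2.trans e3).trans (Near.insert_right hψ L ((hξ.insert L' hpp).prodMk hψm)
    (hp.prodMk hψm) (e4.prodMk (Near.refl _)))

theorem isNearAction_prNet (hξ : IsModerate ξ) (hψ : IsModerate ψ)
    (h : IsNearAction (pairNet ξ ψ)) : IsNearAction (prNet n ξ ψ) := by
  have hτ : ∀ {T : Type} [NormedAddCommGroup T] [NormedSpace ℝ T],
      IsModerate (taylorNet p q n T) := isModerate_taylorNet
  constructor
  · have hb := isModerate_snd_fst (T := ℝ) (E := RSpace p) (F := MultiIndex p n → RSpace q)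
    have hx : IsModerate (fun ε (s : ℝ × JetSpace p q n) => ξ ε (0, s.2.1)) := hξ.insert 0 hb
    have hn : Near (fun ε (s : ℝ × JetSpace p q n) => ξ ε (0, s.2.1)) (fun _ s => s.2.1) :=
      h.base.zero_apply hb
    have hA := hξ.transNet hψ (0 : ℝ →L[ℝ] ℝ) (hτ (T := ℝ))
    have e := ((transNet_zero_near hξ h (hτ (T := ℝ))).jetNet hA hτ n).insert (hA.jetNet n)
      (ContinuousLinearMap.id ℝ ℝ) (IsModerate.snd.prodMk hx) (IsModerate.snd.prodMk hb)
      ((Near.refl _).prodMk hn)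
    refine (hn.prodMk e).trans (Near.of_eq fun ε s => Prod.ext rfl ?_)
    exact prFun_taylorPoly s.2
  · set L := ContinuousLinearMap.fst ℝ ℝ ℝ
    set L' := ContinuousLinearMap.snd ℝ ℝ ℝ
    have hb := isModerate_snd_fst (T := ℝ × ℝ) (E := RSpace p) (F := MultiIndex p n → RSpace q)
    have hx' := hξ.insert L' hb
    have hY := hξ.insert L hx'
    have hA := hξ.transNet hψ L (hτ (T := ℝ × ℝ))
    have hA' := hξ.transNet hψ L' (hτ (T := ℝ × ℝ))
    have hS := hξ.transNet hψ (L + L') (hτ (T := ℝ × ℝ))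
    have hAA := hξ.transNet hψ L hA'
    have hn := h.base.add_apply L L' hb
    have e1 := ((transNet_add_near hξ hψ h (hτ (T := ℝ × ℝ)) L L').jetNet hS hAA n).insert
      (hS.jetNet n) (ContinuousLinearMap.id ℝ (ℝ × ℝ))
      (IsModerate.snd.prodMk (hξ.insert (L + L') hb)) (IsModerate.snd.prodMk hY)
      ((Near.refl _).prodMk hn)
    have hr := hξ.insert (-L) hY
    -- Pulling the end point back by `-L` returns, up to nearness, to the base point reached after
    -- `L'`.
    have e2 := h.base.apply_neg_apply (-L) L (neg_add_cancel _) hx'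
    have hj := (hA'.jetNet n).insert (ContinuousLinearMap.id ℝ (ℝ × ℝ)) (IsModerate.snd.prodMk hr)
    have hj' := (hA'.jetNet n).insert (ContinuousLinearMap.id ℝ (ℝ × ℝ))
      (IsModerate.snd.prodMk hx')
    have e3 := Near.insert_right (hA'.jetNet n) (ContinuousLinearMap.id ℝ (ℝ × ℝ))
      (IsModerate.snd.prodMk hr) (IsModerate.snd.prodMk hx') ((Near.refl _).prodMk e2)
    have e4 := Near.insert_right (hA.jetNet n) (ContinuousLinearMap.id ℝ (ℝ × ℝ))
      ((hr.prodMk hj).prodMk hY) ((hx'.prodMk hj').prodMk hY) ((e2.prodMk e3).prodMk (Near.refl _))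
    -- The exact jet identity joins the jet of the iterated transform, from `e1`, to the
    -- prolongation at the pulled-back jet; `e4` then corrects that jet to the one reached after
    -- `L'`.
    refine hn.prodMk (e1.trans (Near.trans (Near.of_eq fun ε s => ?_) e4))
    exact jetNet_transNet hξ hψ L hA' ε s.1 s.2 _

end Prolongation

end Colombeau

end

theorem proposition4p13 (p q n : ℕ)
    (Φ : Colombeau.GTilde ℝ (Colombeau.RSpace p × Colombeau.RSpace q)
      (Colombeau.RSpace p × Colombeau.RSpace q))
    (hΦ : Colombeau.IsGeneralizedGroupAction Φ) (hproj : Colombeau.IsProjectable Φ) :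
    (∃! P : Colombeau.GTilde ℝ (Colombeau.JetSpace p q n) (Colombeau.JetSpace p q n),
      Colombeau.IsProlongation n Φ P) ∧
    ∀ P : Colombeau.GTilde ℝ (Colombeau.JetSpace p q n) (Colombeau.JetSpace p q n),
      Colombeau.IsProlongation n Φ P → Colombeau.IsGeneralizedGroupAction P := by
  obtain ⟨ξ, ψ, hs⟩ := hproj
  obtain ⟨hξ, hψ, hr⟩ := hs
  refine ⟨⟨Submodule.Quotient.mk ⟨_, Colombeau.isModerate_prNet hξ hψ⟩, ?_, ?_⟩, fun P hP => ?_⟩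
  · rintro ξ' ψ' ⟨hξ', hψ', hr'⟩
    obtain ⟨hnξ, hnψ⟩ :=
      (((Colombeau.represents_iff_of_represents hr).1 hr').2).of_pairNet
    exact (Colombeau.represents_iff_of_represents ⟨_, rfl⟩).2
      ⟨Colombeau.isModerate_prNet hξ' hψ', Colombeau.Near.prNet hξ hψ hξ' hψ' hnξ hnψ⟩
  · intro P hP
    obtain ⟨_, hP⟩ := hP ξ ψ ⟨hξ, hψ, hr⟩
    exact hP.symm
  · exact (Colombeau.isNearAction_prNet hξ hψ (hΦ.isNearAction hr)).isGeneralizedGroupAction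
      (hP ξ ψ ⟨hξ, hψ, hr⟩)
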